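/- Let $N\ge 1$ and let $x,y\ge 0$, $\beta\le 0$ be real numbers with $xy<1$. Let $A=(A_{tj})_{1\le t,j\le N}$ and $B=(B_{sj})_{1\le s\le N-1,\,1\le j\le N}$ be random matrices whose entries are all jointly independent, with $$\mathrm{Prob}(A_{tj}=k)=(1-xy)(xy)^k\quad(k=0,1,2,\ldots),\qquad \mathrm{Prob}(B_{sj}=1)=\frac{-\beta x}{1-\beta x}=1-\mathrm{Prob}(B_{sj}=0).$$ Define random semistandard Young tableaux $T(0),T(1),\ldots,T(2N-1)$ as follows. Let $T(0)=\varnothing$. For $t=1,\ldots,N$, the tableau $T(t)$ is obtained from $T(t-1)$ by RSK row insertion of the word $1^{A_{t1}}2^{A_{t2}}\cdots N^{A_{tN}}$, letter by letter from left to right. For $s=1,\ldots,N-1$, the tableau $T(N+s)$ is obtained from $T(N+s-1)$ by dual RSK insertion of the word $1^{B_{s1}}2^{B_{s2}}\cdots N^{B_{sN}}$; here dual RSK insertion of a strictly increasing word into a semistandard tableau means that its letters are row inserted one after the other from the largest to the smallest (so that the shape grows by a vertical strip). Let $T(t)_j$ denote the length of the $j$-th row of $T(t)$ ($0$ if there is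 no such row), and set $$\lambda_{N-s+1}=T(N+s-1)_{N-s+1},\qquad s=1,2,\ldots,N.$$ Then $\lambda=(\lambda_1,\ldots,\lambda_N)$ is always a partition, $\lambda_1\ge\cdots\ge\lambda_N\ge0$, and its distribution is the Grothendieck measure with homogeneous parameters $x_i=x$, $y_j=y$, $\beta$: for every partition $\lambda$ with at most $N$ parts, $$\mathrm{Prob}(\lambda)=\frac{1}{Z'}\,G_\lambda(x_1,\ldots,x_N)\,\overline{G}_\lambda(y_1,\ldots,y_N)\Big|_{x_i=x,\;y_j=y},\qquad Z'=\prod_{i=1}^N(1-x_i\beta)^{N-1}\prod_{i,j=1}^N\frac1{1-x_iy_j},$$ where $G_\lambda$ and $\overline G_\lambda$ are the polynomials in $N$ variables given by $$G_\lambda(x_1,\ldots,x_N)=\frac{\det\bigl[x_i^{\lambda_j+N-j}(1-\beta x_i)^{j-1}\bigr]_{i,j=1}^N}{\prod_{1\le i<j\le N}(x_i-x_j)},\qquad \overline G_\lambda(y_1,\ldots,y_N)=\frac{\det\bigl[y_i^{\lambda_j+N-j}(1-\beta y_i^{-1})^{N-j}\bigr]_{i,j=1}^N}{\prod_{1\le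 i<j\le N}(y_i-y_j)}.$$ -/

import Mathlib

open MeasureTheory ProbabilityTheory

namespace GrothendieckRSK

/-! ### Row insertion, RSK and dual RSK

A tableau is the list of its rows, from top to bottom, each row being the list of its entries from
left to right. -/

/-- Schensted insertion of the letter `a` into one row: `a` replaces the leftmost entry that is
strictly larger than `a`, and that entry is bumped (second component); if there is no such entry,
`a` is put at the end of the row and nothing is bumped. -/
def rowInsert (a : ℕ) : List ℕ → List ℕ × Option ℕ
  | [] => ([a], none)
  | b :: r => if a < b then (a :: r, some b) else (b :: (rowInsert a r).1, (rowInsert a r).2)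

/-- Row insertion of a letter into a tableau: insert it into the first row; the bumped entry, if
any, is inserted into the next row, and so on. -/
def insertLetter (a : ℕ) : List (List ℕ) → List (List ℕ)
  | [] => [[a]]
  | r :: T =>
    match (rowInsert a r).2 with
    | none => (rowInsert a r).1 :: T
    | some b => (rowInsert a r).1 :: insertLetter b T

/-- RSK insertion of a word: its letters are row inserted one after the other, from left to
right. -/
def insertWord (T : List (List ℕ)) (w : List ℕ) : List (List ℕ) :=
  w.foldl (fun S a => insertLetter a S) T

/-- Dual RSK insertion, into a semistandard tableau, of a strictly increasing word: the letters
are row inserted one after the other from the largest to the smallest. The word `1^{b₁} ⋯ N^{b_N}`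
with all `b_j ∈ {0, 1}` then adds a vertical strip to the shape. -/
def dualInsertWord (T : List (List ℕ)) (w : List ℕ) : List (List ℕ) :=
  w.reverse.foldl (fun S a => insertLetter a S) T

/-- The word `1^{m₁} 2^{m₂} ⋯ N^{m_N}`; the index `j : Fin N` stands for the letter `j + 1`. -/
def rowWord {N : ℕ} (m : Fin N → ℕ) : List ℕ :=
  (List.finRange N).flatMap fun j => List.replicate (m j) (j.val + 1)

/-- The tableaux `T(0), T(1), …, T(2N - 1)`: the rows of the `N × N` matrix `A` are inserted by RSK
in the steps `1, …, N`, and then the rows of the `(N - 1) × N` matrix `B` are inserted by dual RSK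
in the steps `N + 1, …, 2N - 1`. (The process stays constant afterwards.) -/
def tableauAt {N : ℕ} (A : Fin N → Fin N → ℕ) (B : Fin (N - 1) → Fin N → ℕ) :
    ℕ → List (List ℕ)
  | 0 => []
  | t + 1 =>
    if h : t < N then insertWord (tableauAt A B t) (rowWord (A ⟨t, h⟩))
    else if h' : t - N < N - 1 then dualInsertWord (tableauAt A B t) (rowWord (B ⟨t - N, h'⟩))
    else tableauAt A B t

/-- The length of the row with (zero-based) index `i`; it is `0` if there is no such row. -/
def rowLength (T : List (List ℕ)) (i : ℕ) : ℕ := (T.getD i []).length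

/-- The sequence `λ = (λ₁, …, λ_N)` with `λ_{N-s+1} = T(N+s-1)_{N-s+1}` for `s = 1, …, N`.
The index `i : Fin N` stands for the part `λ_{i+1}`, that is, `s = N - i`. -/
def lambdaOf {N : ℕ} (A : Fin N → Fin N → ℕ) (B : Fin (N - 1) → Fin N → ℕ) (i : Fin N) : ℕ :=
  rowLength (tableauAt A B (N + (N - i.val) - 1)) i.val

/-! ### Grothendieck polynomials and Grothendieck measures -/

/-- The product `∏_{i < j} (v_i - v_j)`. -/
def vandermondeProd {R : Type*} [CommRing R] {N : ℕ} (v : Fin N → R) : R :=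
  ∏ i : Fin N, ∏ j ∈ Finset.Ioi i, (v i - v j)

theorem vandermondeProd_dvd_det {R : Type*} [CommRing R] {N : ℕ} (v : Fin N → R)
    (f : Fin N → Polynomial R) :
    vandermondeProd v ∣ (Matrix.of fun i j => (f j).eval (v i)).det := by
  nontriviality R
  have hV : vandermondeProd v ∣ (Matrix.vandermonde v).det := by
    rw [Matrix.det_vandermonde]
    refine Finset.prod_dvd_prod_of_dvd _ _ fun i _ => Finset.prod_dvd_prod_of_dvd _ _ fun j _ => ?_
    exact ⟨-1, by ring⟩
  refine hV.trans ?_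
  set p : Polynomial R := ∏ i : Fin N, (Polynomial.X - Polynomial.C (v i)) with hp
  have hmonic : p.Monic := Polynomial.monic_prod_of_monic _ _ fun i _ => Polynomial.monic_X_sub_C _
  have hdeg : p.degree = (N : ℕ) := by
    rw [Polynomial.degree_eq_natDegree hmonic.ne_zero, hp,
      Polynomial.natDegree_prod_of_monic _ _ fun i _ => Polynomial.monic_X_sub_C _]
    simp
  have hroot : ∀ i, p.eval (v i) = 0 := fun i => by
    rw [hp, Polynomial.eval_prod]
    exact Finset.prod_eq_zero (Finset.mem_univ i) (by simp)
  have key : (Matrix.of fun i j => (f j).eval (v i)) =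
      Matrix.vandermonde v * Matrix.of fun k j => ((f j).modByMonic p).coeff (k : Fin N).val := by
    ext i j
    have h1 : (f j).eval (v i) = ((f j).modByMonic p).eval (v i) := by
      conv_lhs => rw [← Polynomial.modByMonic_add_div (f j) p]
      simp [hroot]
    have h2 : ((f j).modByMonic p).degree < (N : ℕ) := by
      rw [← hdeg]; exact Polynomial.degree_modByMonic_lt _ hmonic
    rw [Matrix.of_apply, h1, Matrix.mul_apply]
    simp only [Matrix.vandermonde_apply, Matrix.of_apply]
    rw [Polynomial.eval, Polynomial.eval₂_eq_sum,
      ← Polynomial.sum_fin (fun e a => (RingHom.id R) a * v i ^ e) (by simp) h2]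
    refine Finset.sum_congr rfl fun k _ => ?_
    simp [mul_comm]
  rw [key, Matrix.det_mul]
  exact Dvd.intro _ rfl

/-- The numerator `det [f_j(z_i)]_{i,j}` as a polynomial in the variables `z_1, …, z_N`. -/
noncomputable def alternantDet {N : ℕ} (f : Fin N → Polynomial ℝ) : MvPolynomial (Fin N) ℝ :=
  (Matrix.of fun i j : Fin N => Polynomial.aeval (MvPolynomial.X i) (f j)).det

theorem exists_quotient {N : ℕ} (f : Fin N → Polynomial ℝ) :
    ∃ Q : MvPolynomial (Fin N) ℝ, alternantDet f = vandermondeProd MvPolynomial.X * Q := by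
  have h := vandermondeProd_dvd_det (MvPolynomial.X : Fin N → MvPolynomial (Fin N) ℝ)
    (fun j => (f j).map (algebraMap ℝ (MvPolynomial (Fin N) ℝ)))
  simp only [Polynomial.eval_map_algebraMap] at h
  exact h

/-- The polynomial `det [f_j(z_i)]_{i,j} / ∏_{i < j} (z_i - z_j)`. -/
noncomputable def alternantQuotient {N : ℕ} (f : Fin N → Polynomial ℝ) :
    MvPolynomial (Fin N) ℝ :=
  (exists_quotient f).choose

theorem alternantQuotient_spec {N : ℕ} (f : Fin N → Polynomial ℝ) :
    alternantDet f = vandermondeProd MvPolynomial.X * alternantQuotient f :=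
  (exists_quotient f).choose_spec

/-- The Grothendieck polynomial
`G_λ(z) = det [z_i^{λ_j + N - j} (1 - β z_i)^{j - 1}] / ∏_{i < j} (z_i - z_j)`. -/
noncomputable def grothendieckG {N : ℕ} (β : ℝ) (lam : Fin N → ℕ) : MvPolynomial (Fin N) ℝ :=
  alternantQuotient fun j => Polynomial.X ^ (lam j + (N - 1 - j.val)) *
    (1 - Polynomial.C β * Polynomial.X) ^ j.val

/-- The polynomial
`Ḡ_λ(z) = det [z_i^{λ_j + N - j} (1 - β z_i⁻¹)^{N - j}] / ∏_{i < j} (z_i - z_j)`,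
where `z^{λ_j + N - j} (1 - β z⁻¹)^{N - j}` is the polynomial `z^{λ_j} (z - β)^{N - j}`. -/
noncomputable def grothendieckGbar {N : ℕ} (β : ℝ) (lam : Fin N → ℕ) : MvPolynomial (Fin N) ℝ :=
  alternantQuotient fun j => Polynomial.X ^ lam j *
    (Polynomial.X - Polynomial.C β) ^ (N - 1 - j.val)

/-- The weight `G_λ(x) Ḡ_λ(y) / Z'` of the partition `λ` under the Grothendieck measure, where
`Z' = ∏_i (1 - x_i β)^{N - 1} ∏_{i,j} (1 - x_i y_j)⁻¹`. -/
noncomputable def grothendieckWeight {N : ℕ} (β : ℝ) (x y : Fin N → ℝ) (lam : Fin N → ℕ) : ℝ :=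
  1 / ((∏ i, (1 - x i * β) ^ (N - 1)) * ∏ i, ∏ j, (1 - x i * y j)⁻¹) *
    MvPolynomial.eval x (grothendieckG β lam) * MvPolynomial.eval y (grothendieckGbar β lam)

end GrothendieckRSK

/-!
The proof computes the joint law of the shapes of all tableaux and then sums it.

**Growth of arrays.** A semistandard tableau is encoded by the interlacing array of the numbers of
entries `≤ k` in row `i` (`countArray`). Both insertions act on the levels `k` of this array by a
local rule (`Cell`, `cell_insertWord`): the new level `k + 1` is a function of the old levels `k` and
`k + 1`, of the new level `k`, and of the number of letters `k + 1` in the word. The rule can be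
inverted (`Cell.exists`, `Cell.unique`), so that the pairs of a tableau and a word correspond to the
pairs of a new tableau and an old shape that differs from the new shape by a horizontal strip (RSK)
or a vertical strip (dual RSK): `RowStep.exists`, `RowStep.unique`. The law of an inserted word
depends only on its length, hence by induction on the steps the probability of an array, together
with the prescribed rows `lambda_{N-s+1}`, is a constant times `x` to the number of boxes times a
weighted number of chains of shapes (`real_stateEvent_zero`). Summation over the tableaux of a given
shape gives a Schur polynomial in `x` (`real_stateEvent`); the chains of horizontal strips of the
first `N` steps give a Schur polynomial in `y`.

**Summation over the chains.** Both Schur polynomials are quotients of alternants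
(`vandermondeProd_mul_schurSum`). After `s` vertical strips the row `q = N - 1 - s`, counted from
zero, is prescribed. The rows above `q` are not yet prescribed, those below `q` are already. As row
`q` is fixed, the conditions on the two groups of rows decouple, and the sum over the chains is a
product of a sum over the past of the rows and a sum over their future (`diagSum_eq_mul`). In each of
the two sums the order of the rows can be ignored, because a collision of two adjacent rows produces
two equal rows of an alternant (`beforeDet_eq_sum`, `afterDet_eq_sum`). Therefore every row moves
independently, a step multiplies its row of the determinant by `y - β` or by `1 - β x`, and the two
sums are the determinants in the definitions of the two Grothendieck polynomials. These identities
are proved for indeterminates, where the Vandermonde product can be cancelled, and then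
specialized to equal arguments (`sum_schurSum_mul_diagSum`).
-/

namespace GrothendieckRSK

/-! ### Insertion of a word into a row -/

/-- The number of entries `≤ k` of a row. -/
def countLE (r : List ℕ) (k : ℕ) : ℕ := r.countP (· ≤ k)

theorem countLE_cons (a : ℕ) (r : List ℕ) (k : ℕ) :
    countLE (a :: r) k = countLE r k + if a ≤ k then 1 else 0 := by
  simp [countLE, List.countP_cons]

theorem countLE_append (r s : List ℕ) (k : ℕ) :
    countLE (r ++ s) k = countLE r k + countLE s k := by
  simp [countLE, List.countP_append]

@[simp] theorem countLE_nil (k : ℕ) : countLE [] k = 0 := rfl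

theorem countLE_mono (r : List ℕ) {k l : ℕ} (h : k ≤ l) : countLE r k ≤ countLE r l := by
  unfold countLE
  exact List.countP_mono_left fun x _ hx => by simp at hx ⊢; omega

theorem countLE_eq_length {r : List ℕ} {k : ℕ} (h : ∀ b ∈ r, b ≤ k) :
    countLE r k = r.length := by
  unfold countLE
  rw [List.countP_eq_length]
  simpa using h

theorem countLE_eq_zero {r : List ℕ} {k : ℕ} (h : ∀ b ∈ r, k < b) : countLE r k = 0 := by
  unfold countLE
  rw [List.countP_eq_zero]
  simpa using h

theorem countLE_succ (r : List ℕ) (k : ℕ) :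
    countLE r (k + 1) = countLE r k + r.count (k + 1) := by
  induction r with
  | nil => simp
  | cons a r ih =>
    rw [countLE_cons, countLE_cons, List.count_cons, ih]
    by_cases h1 : a ≤ k
    · have h2 : a ≠ k + 1 := by omega
      have h3 : a ≤ k + 1 := by omega
      simp [h1, h2, h3]; omega
    · by_cases h2 : a = k + 1
      · simp [h2]; omega
      · have h3 : ¬ a ≤ k + 1 := by omega
        simp [h1, h2, h3]

theorem rowInsert_perm (a : ℕ) (r : List ℕ) :
    ((rowInsert a r).1 ++ (rowInsert a r).2.toList).Perm (a :: r) := by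
  induction r with
  | nil => simp [rowInsert]
  | cons b r ih =>
    unfold rowInsert
    split_ifs with h
    · simp
    · simpa using (ih.cons b).trans (List.Perm.swap a b r)

theorem mem_of_mem_rowInsert {a : ℕ} {r : List ℕ} {b : ℕ} (h : b ∈ (rowInsert a r).1) :
    b = a ∨ b ∈ r := by
  have := (rowInsert_perm a r).subset (List.mem_append_left _ h)
  simpa using this

theorem rowInsert_sorted (a : ℕ) {r : List ℕ} (hr : r.Pairwise (· ≤ ·)) :
    (rowInsert a r).1.Pairwise (· ≤ ·) := by
  induction r with
  | nil => simp [rowInsert]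
  | cons b r ih =>
    rw [List.pairwise_cons] at hr
    unfold rowInsert
    split_ifs with h
    · rw [List.pairwise_cons]
      exact ⟨fun c hc => h.le.trans (hr.1 c hc), hr.2⟩
    · rw [List.pairwise_cons]
      refine ⟨fun c hc => ?_, ih hr.2⟩
      rcases mem_of_mem_rowInsert hc with rfl | hc
      · omega
      · exact hr.1 c hc

theorem countLE_rowInsert (a : ℕ) {r : List ℕ} (hr : r.Pairwise (· ≤ ·)) (k : ℕ) :
    countLE (rowInsert a r).1 k =
      if k < a then countLE r k else max (countLE r k) (countLE r a + 1) := by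
  induction r with
  | nil =>
    simp only [rowInsert, countLE_cons, countLE_nil]
    split_ifs <;> omega
  | cons b r ih =>
    rw [List.pairwise_cons] at hr
    unfold rowInsert
    by_cases h : a < b
    · have h0 : countLE r a = 0 := countLE_eq_zero fun c hc => lt_of_lt_of_le h (hr.1 c hc)
      have h1 : k < b → countLE r k = 0 := fun hk =>
        countLE_eq_zero fun c hc => lt_of_lt_of_le hk (hr.1 c hc)
      simp only [h, if_true, countLE_cons, h0]
      split_ifs <;> omega
    · simp only [h, if_false, countLE_cons, ih hr.2]
      split_ifs <;> omega

theorem rowInsert_bumped {a : ℕ} {r : List ℕ} (hr : r.Pairwise (· ≤ ·)) {b : ℕ}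
    (hb : b ∈ (rowInsert a r).2) : a < b ∧ b ∈ r ∧ ∀ c ∈ r, a < c → b ≤ c := by
  induction r with
  | nil => simp [rowInsert] at hb
  | cons d r ih =>
    rw [List.pairwise_cons] at hr
    unfold rowInsert at hb
    split_ifs at hb with h
    · simp only [Option.mem_def, Option.some.injEq] at hb
      subst hb
      refine ⟨h, by simp, fun c hc _ => ?_⟩
      rcases List.mem_cons.1 hc with rfl | hc
      · exact le_rfl
      · exact hr.1 c hc
    · obtain ⟨h1, h2, h3⟩ := ih hr.2 hb
      refine ⟨h1, by simp [h2], fun c hc hac => ?_⟩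
      rcases List.mem_cons.1 hc with rfl | hc
      · omega
      · exact h3 c hc hac

theorem self_mem_rowInsert (a : ℕ) (r : List ℕ) : a ∈ (rowInsert a r).1 := by
  induction r with
  | nil => simp [rowInsert]
  | cons b r ih =>
    unfold rowInsert
    split_ifs <;> simp [ih]

/-- Insertion of a word into one row, letter by letter from left to right: the new row, and the
word of the bumped letters in the order in which they are bumped. -/
def bumpWord : List ℕ → List ℕ → List ℕ × List ℕ
  | r, [] => (r, [])
  | r, a :: w =>
    ((bumpWord (rowInsert a r).1 w).1,
      (rowInsert a r).2.toList ++ (bumpWord (rowInsert a r).1 w).2)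

theorem bumpWord_perm (r w : List ℕ) :
    ((bumpWord r w).1 ++ (bumpWord r w).2).Perm (r ++ w) := by
  induction w generalizing r with
  | nil => simp [bumpWord]
  | cons a w ih =>
    have h1 := ih (rowInsert a r).1
    have h2 := rowInsert_perm a r
    rw [List.perm_iff_count] at *
    intro c
    have h1 := h1 c
    have h2 := h2 c
    simp only [bumpWord, List.count_append, List.count_cons] at *
    omega

theorem countLE_bumpWord (r w : List ℕ) (k : ℕ) :
    countLE (bumpWord r w).1 k + countLE (bumpWord r w).2 k = countLE r k + countLE w k := by
  rw [← countLE_append, ← countLE_append]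
  exact (bumpWord_perm r w).countP_eq _

theorem mem_bumpWord_or {r w : List ℕ} {b : ℕ}
    (h : b ∈ (bumpWord r w).1 ∨ b ∈ (bumpWord r w).2) : b ∈ r ∨ b ∈ w := by
  have := (bumpWord_perm r w).mem_iff (a := b)
  simpa using this.1 (by simpa using h)

theorem bumpWord_sorted {r : List ℕ} (hr : r.Pairwise (· ≤ ·)) (w : List ℕ) :
    (bumpWord r w).1.Pairwise (· ≤ ·) := by
  induction w generalizing r with
  | nil => exact hr
  | cons a w ih => exact ih (rowInsert_sorted a hr)

theorem countLE_le_bumpWord {r : List ℕ} (hr : r.Pairwise (· ≤ ·)) (w : List ℕ) (k : ℕ) :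
    countLE r k ≤ countLE (bumpWord r w).1 k := by
  induction w generalizing r with
  | nil => exact le_rfl
  | cons a w ih =>
    refine le_trans ?_ (ih (rowInsert_sorted a hr))
    rw [countLE_rowInsert a hr]
    split_ifs <;> omega

theorem countLE_bumpWord_of_lt {r : List ℕ} (hr : r.Pairwise (· ≤ ·)) {w : List ℕ} {k : ℕ}
    (hw : ∀ a ∈ w, k < a) : countLE (bumpWord r w).1 k = countLE r k := by
  induction w generalizing r with
  | nil => rfl
  | cons a w ih =>
    rw [List.forall_mem_cons] at hw
    refine (ih (rowInsert_sorted a hr) hw.2).trans ?_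
    rw [countLE_rowInsert a hr, if_pos hw.1]

/-- Row insertion of a weakly increasing word, in terms of the numbers of entries `≤ k`. -/
theorem countLE_bumpWord_of_sorted {r : List ℕ} (hr : r.Pairwise (· ≤ ·)) {w : List ℕ}
    (hw : w.Pairwise (· ≤ ·)) (k : ℕ) :
    countLE (bumpWord r w).1 (k + 1) =
      max (countLE (bumpWord r w).1 k) (countLE r (k + 1)) + w.count (k + 1) := by
  induction w generalizing r with
  | nil =>
    have := countLE_mono r (Nat.le_add_right k 1)
    simp only [bumpWord, List.count_nil]; omega
  | cons a w ih =>
    rw [List.pairwise_cons] at hw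
    have hs := rowInsert_sorted a hr
    have h1 := ih hs hw.2
    simp only [bumpWord, List.count_cons]
    rw [h1, countLE_rowInsert a hr]
    rcases lt_trichotomy (k + 1) a with h | h | h
    · have : a ≠ k + 1 := by omega
      simp [h, this]
    · have h2 : countLE (bumpWord (rowInsert a r).1 w).1 k = countLE r k := by
        rw [countLE_bumpWord_of_lt hs (fun b hb => by have := hw.1 b hb; omega),
          countLE_rowInsert a hr, if_pos (by omega)]
      have h3 := countLE_mono r (Nat.le_add_right k 1)
      subst h
      have h4 := countLE_rowInsert (k + 1) hr (k + 1)
      rw [if_neg (lt_irrefl _)] at h4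
      simp [h2]; omega
    · have h2 := countLE_le_bumpWord hs w k
      rw [countLE_rowInsert a hr, if_neg (by omega)] at h2
      have : a ≠ k + 1 := by omega
      have h4 : ¬ k + 1 < a := by omega
      simp [h4, this]; omega

theorem bumpWord_snd_bumped {r : List ℕ} (hr : r.Pairwise (· ≤ ·)) {w : List ℕ}
    (hw : w.Pairwise (· ≤ ·)) {b : ℕ} (hb : b ∈ (bumpWord r w).2) :
    b ∈ r ∧ ∃ a ∈ w, a < b := by
  induction w generalizing r with
  | nil => simp [bumpWord] at hb
  | cons a w ih =>
    rw [List.pairwise_cons] at hw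
    rcases List.mem_append.1 hb with hb | hb
    · obtain ⟨h1, h2, -⟩ := rowInsert_bumped hr (by simpa using hb)
      exact ⟨h2, a, by simp, h1⟩
    · obtain ⟨h1, c, hc, hcb⟩ := ih (rowInsert_sorted a hr) hw.2 hb
      refine ⟨?_, c, by simp [hc], hcb⟩
      rcases mem_of_mem_rowInsert h1 with rfl | h
      · have := hw.1 c hc
        omega
      · exact h

/-- The letters bumped by a weakly increasing word form a weakly increasing word. -/
theorem bumpWord_snd_sorted {r : List ℕ} (hr : r.Pairwise (· ≤ ·)) {w : List ℕ}
    (hw : w.Pairwise (· ≤ ·)) : (bumpWord r w).2.Pairwise (· ≤ ·) := by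
  induction w generalizing r with
  | nil => simp [bumpWord]
  | cons a w ih =>
    rw [List.pairwise_cons] at hw
    have hs := rowInsert_sorted a hr
    rw [bumpWord, List.pairwise_append]
    refine ⟨?_, ih hs hw.2, fun b hb c hc => ?_⟩
    · cases (rowInsert a r).2 <;> simp
    · obtain ⟨h1, h2, h3⟩ := rowInsert_bumped hr (by simpa using hb)
      obtain ⟨h4, d, hd, hdc⟩ := bumpWord_snd_bumped hs hw.2 hc
      have h5 := hw.1 d hd
      rcases mem_of_mem_rowInsert h4 with rfl | h
      · omega
      · exact h3 c h (by omega)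

theorem bumpWord_snd_le {r : List ℕ} (hr : r.Pairwise (· ≤ ·)) {w : List ℕ}
    (hw : w.Pairwise (· > ·)) {p : ℕ} (hp : p ∈ r) (hwp : ∀ a ∈ w, a < p) {b : ℕ}
    (hb : b ∈ (bumpWord r w).2) : b ≤ p := by
  induction w generalizing r p with
  | nil => simp [bumpWord] at hb
  | cons a w ih =>
    rw [List.pairwise_cons] at hw
    rw [List.forall_mem_cons] at hwp
    rcases List.mem_append.1 hb with hb | hb
    · obtain ⟨-, -, h3⟩ := rowInsert_bumped hr (by simpa using hb)
      exact h3 p hp hwp.1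
    · exact (ih (rowInsert_sorted a hr) hw.2 (self_mem_rowInsert a r) hw.1 hb).trans hwp.1.le

/-- The letters bumped by a strictly decreasing word form a strictly decreasing word. -/
theorem bumpWord_snd_decreasing {r : List ℕ} (hr : r.Pairwise (· ≤ ·)) {w : List ℕ}
    (hw : w.Pairwise (· > ·)) : (bumpWord r w).2.Pairwise (· > ·) := by
  induction w generalizing r with
  | nil => simp [bumpWord]
  | cons a w ih =>
    rw [List.pairwise_cons] at hw
    have hs := rowInsert_sorted a hr
    rw [bumpWord, List.pairwise_append]
    refine ⟨?_, ih hs hw.2, fun b hb c hc => ?_⟩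
    · cases (rowInsert a r).2 <;> simp
    · obtain ⟨h1, -, -⟩ := rowInsert_bumped hr (by simpa using hb)
      exact lt_of_le_of_lt (bumpWord_snd_le hs hw.2 (self_mem_rowInsert a r) hw.1 hc) h1

/-- Row insertion of a strictly decreasing word, in terms of the numbers of entries `≤ k`. -/
theorem countLE_bumpWord_of_decreasing {r : List ℕ} (hr : r.Pairwise (· ≤ ·)) {w : List ℕ}
    (hw : w.Pairwise (· > ·)) (h0 : ∀ a ∈ w, 0 < a) (k : ℕ) :
    countLE (bumpWord r w).1 (k + 1) =
      if w.count (k + 1) = 1 then countLE r (k + 1) + 1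
      else max (countLE (bumpWord r w).1 k) (countLE r (k + 1)) := by
  induction w generalizing r k with
  | nil =>
    have := countLE_mono r (Nat.le_add_right k 1)
    simp only [bumpWord, List.count_nil]
    simp [this]
  | cons a w ih =>
    rw [List.pairwise_cons] at hw
    rw [List.forall_mem_cons] at h0
    have hs := rowInsert_sorted a hr
    have h1 := ih hs hw.2 h0.2
    have h2 : ∀ k, countLE (bumpWord (rowInsert a r).1 w).1 k ≤
        countLE (rowInsert a r).1 k + 1 := by
      intro k
      induction k with
      | zero => rw [countLE_bumpWord_of_lt hs h0.2]; omega
      | succ k ih =>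
        rw [h1]
        have := countLE_mono (rowInsert a r).1 (Nat.le_add_right k 1)
        split_ifs <;> omega
    simp only [bumpWord, List.count_cons]
    rw [h1]
    have h5 := countLE_rowInsert a hr (k + 1)
    have h6 := countLE_rowInsert a hr k
    have h7 := h2 k
    have h8 := countLE_mono r (Nat.le_add_right k 1)
    rcases lt_trichotomy (k + 1) a with h | h | h
    · have : a ≠ k + 1 := by omega
      rw [if_pos h] at h5
      simp [h5, this]
    · have h3 : w.count (k + 1) = 0 := List.count_eq_zero.2 fun hc => by
        have := hw.1 _ hc; omega
      subst h
      rw [if_neg (lt_irrefl _)] at h5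
      rw [if_pos (by omega)] at h6
      simp [h3]; omega
    · have h3 : w.count (k + 1) = 0 := List.count_eq_zero.2 fun hc => by
        have := hw.1 _ hc; omega
      have h4 := countLE_le_bumpWord hs w k
      have : a ≠ k + 1 := by omega
      rw [if_neg (by omega)] at h5 h6
      simp [h3, this]; omega

theorem insertWord_getD_zero (T : List (List ℕ)) (w : List ℕ) :
    (insertWord T w).getD 0 [] = (bumpWord (T.getD 0 []) w).1 ∧
      ∀ i, (insertWord T w).getD (i + 1) [] =
        (insertWord T.tail (bumpWord (T.getD 0 []) w).2).getD i [] := by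
  have cons : ∀ (w r : List ℕ) (T : List (List ℕ)),
      insertWord (r :: T) w = (bumpWord r w).1 :: insertWord T (bumpWord r w).2 := by
    intro w
    induction w with
    | nil => intro r T; simp [insertWord, bumpWord]
    | cons a w ih =>
      intro r T
      have h : insertWord (r :: T) (a :: w) = insertWord (insertLetter a (r :: T)) w := rfl
      rw [h, insertLetter]
      cases h2 : (rowInsert a r).2 with
      | none => simp [ih, bumpWord, h2]
      | some b =>
        simp only [bumpWord, h2]
        exact ih _ _
  cases T with
  | cons r T => simp [cons]
  | nil =>
    cases w with
    | nil => simp [insertWord, bumpWord]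
    | cons a w =>
      have h : insertWord [] (a :: w) = insertWord [[a]] w := rfl
      simp [h, cons, bumpWord, rowInsert]

/-- The word that is inserted into row `i` when the word `w` is inserted into the tableau `T`. -/
def wordAt (T : List (List ℕ)) (w : List ℕ) : ℕ → List ℕ
  | 0 => w
  | i + 1 => (bumpWord (T.getD i []) (wordAt T w i)).2

theorem insertWord_getD (T : List (List ℕ)) (w : List ℕ) (i : ℕ) :
    (insertWord T w).getD i [] = (bumpWord (T.getD i []) (wordAt T w i)).1 := by
  have shift : ∀ (i : ℕ) (T : List (List ℕ)) (w : List ℕ),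
      wordAt T w (i + 1) = wordAt T.tail (bumpWord (T.getD 0 []) w).2 i := by
    intro i
    induction i with
    | zero => intro T w; rfl
    | succ i ih =>
      intro T w
      rw [wordAt, ih, wordAt]
      cases T <;> simp
  induction i generalizing T w with
  | zero => exact (insertWord_getD_zero T w).1
  | succ i ih =>
    rw [(insertWord_getD_zero T w).2, ih, shift]
    cases T <;> simp

/-! ### Growth of interlacing arrays -/

/-- The sequences `lam` and `mu` interlace: `mu / lam` is a horizontal strip. Partitions are
represented by weakly decreasing sequences `ℕ → ℕ` that are eventually zero. -/
def Interlace (lam mu : ℕ → ℕ) : Prop := ∀ i, mu (i + 1) ≤ lam i ∧ lam i ≤ mu i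

/-- `mu / lam` is a horizontal strip (`v = false`) or a vertical strip (`v = true`). -/
def Strip : Bool → (ℕ → ℕ) → (ℕ → ℕ) → Prop
  | false, lam, mu => Interlace lam mu
  | true, lam, mu => ∀ i, lam i ≤ mu i ∧ mu i ≤ lam i + 1

/-- The new value `r` of an entry in the next level, when `m` is the old value of the entry, `n` the
new value of the entry one level below, and `c` copies of the letter of this level are inserted
into the row. -/
def CellRule : Bool → ℕ → ℕ → ℕ → ℕ → Prop
  | false, c, m, n, r => r = max m n + c
  | true, c, m, n, r => c ≤ 1 ∧ r = if c = 1 then m + 1 else max m n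

/-- The local growth rule of row insertion (`v = false`) and dual row insertion (`v = true`): the
shapes of the entries `≤ k` and `≤ k + 1` are `lam`, `mu` before and `nu`, `rho` after the
insertion of a word with `a` letters `k + 1`; then `c i` is the number of letters `k + 1` that are
inserted into row `i`. -/
def Cell (v : Bool) (lam mu nu rho : ℕ → ℕ) (a : ℕ) : Prop :=
  ∃ c : ℕ → ℕ, c 0 = a ∧ ∀ i, CellRule v (c i) (mu i) (nu i) (rho i) ∧
    rho i + c (i + 1) + lam i = mu i + nu i + c i

theorem Interlace.antitone_left {lam mu : ℕ → ℕ} (h : Interlace lam mu) : Antitone lam :=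
  antitone_nat_of_succ_le fun i => (h (i + 1)).2.trans (h i).1

theorem Interlace.antitone_right {lam mu : ℕ → ℕ} (h : Interlace lam mu) : Antitone mu :=
  antitone_nat_of_succ_le fun i => (h i).1.trans (h i).2

theorem Strip.le {v : Bool} {lam mu : ℕ → ℕ} (h : Strip v lam mu) (i : ℕ) : lam i ≤ mu i := by
  cases v
  · exact (h i).2
  · exact (h i).1

theorem Cell.forward {v : Bool} {lam mu nu rho : ℕ → ℕ} {a : ℕ} (hlm : Interlace lam mu)
    (hln : Strip v lam nu) (hnu : Antitone nu) (hc : Cell v lam mu nu rho a) :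
    Strip v mu rho ∧ Interlace nu rho := by
  obtain ⟨c, -, hc⟩ := hc
  have hn := fun i => hnu (Nat.le_add_right i 1)
  cases v
  · simp only [Strip, CellRule, Interlace] at *
    refine ⟨fun i => ?_, fun i => ?_⟩ <;>
    · have h1 := hc i
      have h2 := hc (i + 1)
      have h3 := hlm i
      have h4 := hln i
      have h5 := hn i
      omega
  · simp only [Strip, CellRule, Interlace] at *
    refine ⟨fun i => ?_, fun i => ?_⟩ <;>
    · have h1 := hc i
      have h2 := hc (i + 1)
      have h3 := hlm i
      have h4 := hln i
      have h5 := hn i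
      have h6 := hlm (i + 1)
      have h7 := hln (i + 1)
      split_ifs at h1 h2 <;> omega

/-- The carries of a cell vanish below the last row. -/
theorem cell_carry_eq_zero {v : Bool} {lam mu nu rho c : ℕ → ℕ} (hln : Strip v lam nu)
    (hc : ∀ i, CellRule v (c i) (mu i) (nu i) (rho i) ∧
      rho i + c (i + 1) + lam i = mu i + nu i + c i) {i : ℕ} (hi : nu i = 0) : c (i + 1) = 0 := by
  have h1 := hc i
  have h2 := hln.le i
  cases v
  · simp only [CellRule] at h1; omega
  · simp only [CellRule] at h1
    split_ifs at h1 <;> omega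

theorem cell_size {v : Bool} {lam mu nu rho : ℕ → ℕ} {a n : ℕ} (hln : Strip v lam nu)
    (hc : Cell v lam mu nu rho a) (hn : nu n = 0) :
    ∑ i ∈ Finset.range (n + 1), rho i + ∑ i ∈ Finset.range (n + 1), lam i =
      ∑ i ∈ Finset.range (n + 1), mu i + ∑ i ∈ Finset.range (n + 1), nu i + a := by
  obtain ⟨c, rfl, hc⟩ := hc
  have key : ∀ m, ∑ i ∈ Finset.range m, rho i + ∑ i ∈ Finset.range m, lam i + c m =
      ∑ i ∈ Finset.range m, mu i + ∑ i ∈ Finset.range m, nu i + c 0 := by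
    intro m
    induction m with
    | zero => simp
    | succ m ih =>
      have := (hc m).2
      simp only [Finset.sum_range_succ]
      omega
  have h1 := key (n + 1)
  rw [cell_carry_eq_zero hln hc hn] at h1
  exact h1

/-- In a cell of dual insertion, a carry is determined by the three later shapes and the next
carry. -/
theorem cell_carry_eq {lam mu nu rho c : ℕ → ℕ} (hlm : Interlace lam mu) (hln : Strip true lam nu)
    (hc : ∀ i, CellRule true (c i) (mu i) (nu i) (rho i) ∧
      rho i + c (i + 1) + lam i = mu i + nu i + c i) (i : ℕ) :
    c i = if nu i ≤ mu i then rho i - mu i else c (i + 1) := by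
  have h1 := hc i
  have h2 := hln i
  have h3 := hlm i
  simp only [CellRule] at h1
  split_ifs at h1 ⊢ <;> omega

theorem Cell.unique {v : Bool} {lam lam' mu nu rho : ℕ → ℕ} {a a' n : ℕ}
    (hn : ∀ i, n ≤ i → nu i = 0)
    (hlm : Interlace lam mu) (hln : Strip v lam nu) (hc : Cell v lam mu nu rho a)
    (hlm' : Interlace lam' mu) (hln' : Strip v lam' nu) (hc' : Cell v lam' mu nu rho a') :
    lam = lam' ∧ a = a' := by
  obtain ⟨c, rfl, hc⟩ := hc
  obtain ⟨c', rfl, hc'⟩ := hc'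
  suffices H : c = c' by
    subst H
    refine ⟨funext fun i => ?_, rfl⟩
    have h1 := (hc i).2
    have h2 := (hc' i).2
    omega
  cases v
  · funext i
    have h1 := hc i
    have h2 := hc' i
    simp only [CellRule] at h1 h2
    omega
  · have key : ∀ d i, n + 1 ≤ i + d → c i = c' i := by
      intro d
      induction d with
      | zero =>
        intro i hi
        obtain ⟨j, rfl⟩ : ∃ j, i = j + 1 := ⟨i - 1, by omega⟩
        rw [cell_carry_eq_zero hln hc (hn j (by omega)),
          cell_carry_eq_zero hln' hc' (hn j (by omega))]
      | succ d ih =>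
        intro i hi
        rw [cell_carry_eq hlm hln hc, cell_carry_eq hlm' hln' hc', ih (i + 1) (by omega)]
    exact funext fun i => key (n + 1) i (by omega)

/-- The carries in a cell of dual insertion, computed from the last row upwards; the first argument
bounds the number of rows that are inspected. -/
def dualCarry (mu nu rho : ℕ → ℕ) : ℕ → ℕ → ℕ
  | 0, _ => 0
  | f + 1, i => if nu i ≤ mu i then rho i - mu i else dualCarry mu nu rho f (i + 1)

theorem Cell.exists {v : Bool} {mu nu rho : ℕ → ℕ} {n : ℕ} (hn : ∀ i, n ≤ i → rho i = 0)
    (hmu : Antitone mu) (hmr : Strip v mu rho) (hnr : Interlace nu rho) :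
    ∃ lam a, Interlace lam mu ∧ Strip v lam nu ∧ Cell v lam mu nu rho a := by
  have hm := fun i => hmu (Nat.le_add_right i 1)
  cases v
  · simp only [Strip, Cell, CellRule, Interlace] at *
    refine ⟨fun i => min (mu i) (nu i) - (rho (i + 1) - max (mu (i + 1)) (nu (i + 1))), _,
      fun i => ?_, fun i => ?_, fun i => rho i - max (mu i) (nu i), rfl, fun i => ?_⟩ <;>
    · have h1 := hmr i
      have h2 := hmr (i + 1)
      have h3 := hnr i
      have h4 := hnr (i + 1)
      have h5 := hm i
      dsimp only
      omega
  · simp only [Strip, Cell, CellRule, Interlace] at *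
    obtain ⟨c, hc⟩ : ∃ c : ℕ → ℕ, c = fun i => dualCarry mu nu rho (n - i) i := ⟨_, rfl⟩
    have hc1 : ∀ i, c i = if nu i ≤ mu i then rho i - mu i else c (i + 1) := by
      intro i
      rw [hc]
      by_cases hi : i < n
      · obtain ⟨d, hd⟩ : ∃ d, n - i = d + 1 := ⟨n - i - 1, by omega⟩
        have hd' : n - (i + 1) = d := by omega
        simp only [hd, hd', dualCarry]
      · have h1 : n - i = 0 := by omega
        have h2 : n - (i + 1) = 0 := by omega
        have h3 := hn i (by omega)
        simp [h1, h2, dualCarry, h3]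
    have hc2 : ∀ d i, n ≤ i + d → c i ≤ rho i ∧ c i ≤ 1 := by
      intro d
      induction d with
      | zero =>
        intro i hi
        have h1 : n - i = 0 := by omega
        simp [hc, h1, dualCarry]
      | succ d ih =>
        intro i hi
        have h1 := ih (i + 1) (by omega)
        have h2 := hmr i
        have h3 := hnr i
        rw [hc1]
        split_ifs <;> omega
    refine ⟨fun i => if nu i ≤ mu i then nu i - c (i + 1) else nu i - 1, _,
      fun i => ?_, fun i => ?_, c, rfl, fun i => ?_⟩ <;>
    · have h1 := hmr i
      have h2 := hmr (i + 1)
      have h3 := hnr i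
      have h4 := hnr (i + 1)
      have h5 := hm i
      have h6 := hc1 i
      have h7 := hc1 (i + 1)
      have h8 := hc2 n (i + 1) (by omega)
      have h9 := hc2 n (i + 2) (by omega)
      have h10 := hc2 n i (by omega)
      dsimp only
      split_ifs at * <;> omega

/-- The numbers of entries `≤ k` in row `i` of a tableau, for all `k` and `i`: an interlacing
(Gelfand-Tsetlin) array if the tableau is semistandard. -/
def countArray (T : List (List ℕ)) (k i : ℕ) : ℕ := countLE (T.getD i []) k

/-- The rows of `T` are weakly increasing, with entries in `1, …, N`. -/
def RowsSorted (N : ℕ) (T : List (List ℕ)) : Prop :=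
  ∀ i, (T.getD i []).Pairwise (· ≤ ·) ∧ ∀ b ∈ T.getD i [], 0 < b ∧ b ≤ N

/-- The words that are inserted by RSK (weakly increasing) and by dual RSK (strictly
decreasing). -/
def WordSorted : Bool → List ℕ → Prop
  | false, w => w.Pairwise (· ≤ ·)
  | true, w => w.Pairwise (· > ·)

theorem wordAt_mem {N : ℕ} {T : List (List ℕ)} (hT : RowsSorted N T) {w : List ℕ}
    (hw : ∀ a ∈ w, 0 < a ∧ a ≤ N) (i : ℕ) : ∀ a ∈ wordAt T w i, 0 < a ∧ a ≤ N := by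
  induction i with
  | zero => exact hw
  | succ i ih =>
    intro a ha
    rcases mem_bumpWord_or (Or.inr ha) with h | h
    · exact (hT i).2 a h
    · exact ih a h

theorem wordAt_sorted {N : ℕ} {T : List (List ℕ)} (hT : RowsSorted N T) {v : Bool} {w : List ℕ}
    (hw : WordSorted v w) (i : ℕ) : WordSorted v (wordAt T w i) := by
  induction i with
  | zero => exact hw
  | succ i ih =>
    cases v
    · exact bumpWord_snd_sorted (hT i).1 ih
    · exact bumpWord_snd_decreasing (hT i).1 ih

theorem RowsSorted.insertWord {N : ℕ} {T : List (List ℕ)} (hT : RowsSorted N T) {w : List ℕ}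
    (hw : ∀ a ∈ w, 0 < a ∧ a ≤ N) : RowsSorted N (insertWord T w) := by
  intro i
  rw [insertWord_getD]
  refine ⟨bumpWord_sorted (hT i).1 _, fun b hb => ?_⟩
  rcases mem_bumpWord_or (Or.inl hb) with h | h
  · exact (hT i).2 b h
  · exact wordAt_mem hT hw i b h

/-- Row insertion of a word acts on the array of a tableau by the local growth rules. -/
theorem cell_insertWord {N : ℕ} {T : List (List ℕ)} (hT : RowsSorted N T) {v : Bool} {w : List ℕ}
    (hw : ∀ a ∈ w, 0 < a ∧ a ≤ N) (hv : WordSorted v w) (k : ℕ) :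
    Cell v (countArray T k) (countArray T (k + 1)) (countArray (insertWord T w) k)
      (countArray (insertWord T w) (k + 1)) (w.count (k + 1)) := by
  refine ⟨fun i => (wordAt T w i).count (k + 1), rfl, fun i => ?_⟩
  have h1 := wordAt_sorted hT hv i
  simp only [countArray, insertWord_getD]
  constructor
  · cases v
    · simp only [CellRule]
      rw [countLE_bumpWord_of_sorted (hT i).1 h1, max_comm]
    · refine ⟨?_, ?_⟩
      · exact List.nodup_iff_count_le_one.1 (h1.imp fun h => h.ne') _
      · rw [countLE_bumpWord_of_decreasing (hT i).1 h1
          (fun a ha => (wordAt_mem hT hw i a ha).1), max_comm]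
  · have h2 := countLE_bumpWord (T.getD i []) (wordAt T w i) k
    have h3 := countLE_bumpWord (T.getD i []) (wordAt T w i) (k + 1)
    rw [countLE_succ (bumpWord (T.getD i []) (wordAt T w i)).2, countLE_succ (wordAt T w i)] at h3
    simp only [wordAt]
    omega

theorem countArray_zero {N : ℕ} {T : List (List ℕ)} (hT : RowsSorted N T) :
    countArray T 0 = 0 :=
  funext fun i => countLE_eq_zero fun b hb => ((hT i).2 b hb).1

theorem countArray_eq_rowLength {N : ℕ} {T : List (List ℕ)} (hT : RowsSorted N T) (i : ℕ) :
    countArray T N i = rowLength T i :=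
  countLE_eq_length fun b hb => ((hT i).2 b hb).2

/-- `L 0, …, L n` is an interlacing (Gelfand-Tsetlin) array with `L 0 = 0`. -/
def IsGT (n : ℕ) (L : ℕ → ℕ → ℕ) : Prop := L 0 = 0 ∧ ∀ k < n, Interlace (L k) (L (k + 1))

theorem IsGT.eq_zero {n : ℕ} {L : ℕ → ℕ → ℕ} (h : IsGT n L) {k i : ℕ} (hk : k ≤ n) (hi : k ≤ i) :
    L k i = 0 := by
  induction k generalizing i with
  | zero => rw [h.1]; rfl
  | succ k ih =>
    obtain ⟨j, rfl⟩ : ∃ j, i = j + 1 := ⟨i - 1, by omega⟩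
    have h1 := (h.2 k (by omega) j).1
    rw [ih (by omega) (by omega)] at h1
    omega

theorem IsGT.antitone {n : ℕ} {L : ℕ → ℕ → ℕ} (h : IsGT n L) {k : ℕ} (hk : k ≤ n) :
    Antitone (L k) := by
  cases k with
  | zero => rw [h.1]; exact antitone_const
  | succ k => exact (h.2 k hk).antitone_right

theorem IsGT.mono {n m : ℕ} {L : ℕ → ℕ → ℕ} (h : IsGT n L) (hm : m ≤ n) : IsGT m L :=
  ⟨h.1, fun k hk => h.2 k (by omega)⟩

/-- The relation between the arrays of a tableau before and after the insertion of a word with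
`a k` letters `k + 1`. -/
def RowStep (v : Bool) (n : ℕ) (L L' : ℕ → ℕ → ℕ) (a : ℕ → ℕ) : Prop :=
  ∀ k < n, Cell v (L k) (L (k + 1)) (L' k) (L' (k + 1)) (a k)

theorem strip_zero (v : Bool) : Strip v 0 0 := by
  cases v <;> simp [Strip, Interlace]

theorem RowStep.forward {v : Bool} {n : ℕ} {L L' : ℕ → ℕ → ℕ} {a : ℕ → ℕ} (hL : IsGT n L)
    (h0 : L' 0 = 0) (h : RowStep v n L L' a) :
    IsGT n L' ∧ ∀ k ≤ n, Strip v (L k) (L' k) := by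
  have key : ∀ m ≤ n, IsGT m L' ∧ ∀ k ≤ m, Strip v (L k) (L' k) := by
    intro m
    induction m with
    | zero =>
      refine fun _ => ⟨⟨h0, by simp⟩, fun k hk => ?_⟩
      obtain rfl : k = 0 := by omega
      rw [hL.1, h0]
      exact strip_zero v
    | succ m ih =>
      intro hm
      obtain ⟨h1, h2⟩ := ih (by omega)
      obtain ⟨h3, h4⟩ := (h m (by omega)).forward (hL.2 m (by omega)) (h2 m le_rfl)
        (h1.antitone le_rfl)
      refine ⟨⟨h0, fun k hk => ?_⟩, fun k hk => ?_⟩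
      · rcases Nat.lt_succ_iff_lt_or_eq.1 hk with hk | rfl
        · exact h1.2 k hk
        · exact h4
      · rcases Nat.le_succ_iff.1 hk with hk | rfl
        · exact h2 k hk
        · exact h3
  exact key n le_rfl

/-- Insertion can be reversed: the array after the insertion and the shape before the insertion
come from some array before the insertion and some word. -/
theorem RowStep.exists {v : Bool} {n : ℕ} {L' : ℕ → ℕ → ℕ} (hL' : IsGT n L') {mu : ℕ → ℕ}
    (hmu : Antitone mu) (hs : Strip v mu (L' n)) :
    ∃ L a, IsGT n L ∧ L n = mu ∧ RowStep v n L L' a := by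
  induction n generalizing mu with
  | zero =>
    refine ⟨fun _ => 0, 0, ⟨rfl, by simp⟩, funext fun i => ?_, by simp [RowStep]⟩
    have := hs.le i
    rw [hL'.1] at this
    exact (Nat.le_zero.1 this).symm
  | succ n ih =>
    obtain ⟨lam, b, h1, h2, h3⟩ := Cell.exists (n := n + 1)
      (fun i hi => hL'.eq_zero le_rfl hi) hmu hs (hL'.2 n (by omega))
    obtain ⟨L, a, hL, hLn, hc⟩ := ih (hL'.mono (by omega)) h1.antitone_left h2
    refine ⟨fun k => if k ≤ n then L k else mu, fun k => if k < n then a k else b,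
      ⟨by simp [hL.1], fun k hk => ?_⟩, by simp, fun k hk => ?_⟩
    · rcases Nat.lt_succ_iff_lt_or_eq.1 hk with hk | rfl
      · simpa [hk.le, Nat.succ_le_of_lt hk] using hL.2 k hk
      · simpa [hLn] using h1
    · rcases Nat.lt_succ_iff_lt_or_eq.1 hk with hk | rfl
      · simpa [hk, hk.le, Nat.succ_le_of_lt hk] using hc k hk
      · simpa [hLn] using h3

theorem RowStep.unique {v : Bool} {n : ℕ} {L M L' : ℕ → ℕ → ℕ} {a b : ℕ → ℕ} (hL' : IsGT n L')
    (hL : IsGT n L) (hM : IsGT n M) (ha : RowStep v n L L' a) (hb : RowStep v n M L' b)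
    (hn : L n = M n) : (∀ k ≤ n, L k = M k) ∧ ∀ k < n, a k = b k := by
  have hLs := (ha.forward hL hL'.1).2
  have hMs := (hb.forward hM hL'.1).2
  have step : ∀ k < n, L (k + 1) = M (k + 1) → L k = M k ∧ a k = b k := by
    intro k hk h
    have h1 := ha k hk
    have h2 := hL.2 k hk
    rw [h] at h1 h2
    exact Cell.unique (fun i hi => hL'.eq_zero hk.le hi) h2 (hLs k hk.le) h1 (hM.2 k hk)
      (hMs k hk.le) (hb k hk)
  have key : ∀ d ≤ n, L (n - d) = M (n - d) := by
    intro d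
    induction d with
    | zero => exact fun _ => hn
    | succ d ih =>
      intro hd
      refine (step (n - (d + 1)) (by omega) ?_).1
      have : n - (d + 1) + 1 = n - d := by omega
      rw [this]
      exact ih (by omega)
  have h1 : ∀ k ≤ n, L k = M k := by
    intro k hk
    have := key (n - k) (by omega)
    rwa [Nat.sub_sub_self hk] at this
  exact ⟨h1, fun k hk => (step k hk (h1 _ hk)).2⟩

/-- The number of boxes in the first `N` rows of a shape. -/
def size (N : ℕ) (mu : ℕ → ℕ) : ℕ := ∑ i ∈ Finset.range N, mu i

theorem size_eq_of_le {n N : ℕ} (h : n ≤ N) {mu : ℕ → ℕ} (hmu : ∀ i, n ≤ i → mu i = 0) :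
    size N mu = size n mu := by
  refine (Finset.sum_subset (by simpa using h) fun i _ hi => hmu i ?_).symm
  simpa using hi

theorem size_mono {N : ℕ} {mu nu : ℕ → ℕ} (h : ∀ i, mu i ≤ nu i) : size N mu ≤ size N nu :=
  Finset.sum_le_sum fun i _ => h i

theorem RowStep.size_add {v : Bool} {n : ℕ} {L L' : ℕ → ℕ → ℕ} {a : ℕ → ℕ} (hL : IsGT n L)
    (h0 : L' 0 = 0) (h : RowStep v n L L' a) :
    size n (L n) + ∑ k ∈ Finset.range n, a k = size n (L' n) := by
  obtain ⟨hL', hs⟩ := h.forward hL h0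
  have key : ∀ m ≤ n, GrothendieckRSK.size m (L m) + ∑ k ∈ Finset.range m, a k =
      GrothendieckRSK.size m (L' m) := by
    intro m
    induction m with
    | zero => simp [GrothendieckRSK.size]
    | succ m ih =>
      intro hm
      have h1 := ih (by omega)
      have h2 := cell_size (hs m (by omega)) (h m (by omega)) (hL'.eq_zero (by omega) le_rfl)
      have h3 := size_eq_of_le (Nat.le_add_right m 1)
        (fun i hi => hL'.eq_zero (k := m) (by omega) hi)
      have h4 := size_eq_of_le (Nat.le_add_right m 1)
        (fun i hi => hL.eq_zero (k := m) (by omega) hi)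
      rw [Finset.sum_range_succ]
      simp only [GrothendieckRSK.size] at *
      omega
  exact key n le_rfl

/-! ### Weighted sums over chains of shapes -/

/-- The weakly decreasing sequences with at most `N` rows below `mu` from which `mu` is reached by
adding a strip. -/
noncomputable def below (v : Bool) (N : ℕ) (mu : ℕ → ℕ) : Finset (ℕ → ℕ) :=
  Set.Finite.toFinset (s := {nu | Antitone nu ∧ Strip v nu mu ∧ ∀ i, N ≤ i → nu i = 0}) <| by
    refine ((Fintype.piFinset fun i : Fin N => Finset.range (mu i + 1)).finite_toSet.image
      fun f i => if h : i < N then f ⟨i, h⟩ else 0).subset ?_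
    rintro nu ⟨-, h1, h2⟩
    refine ⟨fun i => nu i, ?_, funext fun i => ?_⟩
    · simpa using fun i : Fin N => Nat.lt_succ_of_le (h1.le i)
    · by_cases h : i < N
      · simp [h]
      · simp [h, h2 i (by omega)]

theorem mem_below {v : Bool} {N : ℕ} {mu nu : ℕ → ℕ} :
    nu ∈ below v N mu ↔ Antitone nu ∧ Strip v nu mu ∧ ∀ i, N ≤ i → nu i = 0 := by
  simp [below]

open Classical in
/-- The sum over the chains `mu₀, …, mu_t = mu` of shapes with at most `N` rows, in which each step
adds a strip of the kind `v s`, of the products of `init mu₀` and of the factors `w s` for each box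
added in step `s`; only the chains with `g s mu_s` for `s > 0` contribute. -/
noncomputable def chainSum {R : Type*} [CommRing R] (N : ℕ) (v : ℕ → Bool) (w : ℕ → R)
    (g : ℕ → (ℕ → ℕ) → Prop) (init : (ℕ → ℕ) → R) : ℕ → (ℕ → ℕ) → R
  | 0, mu => init mu
  | t + 1, mu => if g (t + 1) mu then
      ∑ nu ∈ below (v t) N mu, w t ^ (size N mu - size N nu) * chainSum N v w g init t nu
    else 0

theorem map_chainSum {R S : Type*} [CommRing R] [CommRing S] (f : R →+* S) (N : ℕ) (v : ℕ → Bool)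
    (w : ℕ → R) (g : ℕ → (ℕ → ℕ) → Prop) (init : (ℕ → ℕ) → R) (t : ℕ) (mu : ℕ → ℕ) :
    f (chainSum N v w g init t mu) =
      chainSum N v (fun s => f (w s)) g (fun nu => f (init nu)) t mu := by
  induction t generalizing mu with
  | zero => rfl
  | succ t ih =>
    simp only [chainSum]
    split_ifs
    · simp [map_sum, ih]
    · simp

open Classical in
/-- The Schur polynomial in the variables `z 0, …, z (t - 1)`, as a sum over interlacing arrays. -/
noncomputable def schurSum {R : Type*} [CommRing R] (N : ℕ) (z : ℕ → R) (t : ℕ) (mu : ℕ → ℕ) : R :=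
  chainSum N (fun _ => false) z (fun _ _ => True) (fun nu => if nu = 0 then 1 else 0) t mu

theorem schurSum_succ {R : Type*} [CommRing R] (N : ℕ) (z : ℕ → R) (t : ℕ) (mu : ℕ → ℕ) :
    schurSum N z (t + 1) mu =
      ∑ nu ∈ below false N mu, z t ^ (size N mu - size N nu) * schurSum N z t nu := by
  simp [schurSum, chainSum]

theorem schurSum_eq_zero {R : Type*} [CommRing R] (N : ℕ) (z : ℕ → R) {t : ℕ} {mu : ℕ → ℕ} {i : ℕ}
    (hi : t ≤ i) (hmu : mu i ≠ 0) : schurSum N z t mu = 0 := by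
  induction t generalizing mu i with
  | zero =>
    rw [schurSum, chainSum, if_neg]
    rintro rfl
    exact hmu rfl
  | succ t ih =>
    rw [schurSum_succ]
    refine Finset.sum_eq_zero fun nu hnu => ?_
    obtain ⟨j, rfl⟩ : ∃ j, i = j + 1 := ⟨i - 1, by omega⟩
    have h1 := ((mem_below.1 hnu).2.1 j).1
    rw [ih (i := j) (by omega) (by omega), mul_zero]

/-! ### The determinantal formula for Schur polynomials -/

theorem det_sum_rows {R : Type*} [CommRing R] {n : ℕ} (S : Fin n → Finset ℕ) (c : Fin n → ℕ → R)
    (f : Fin n → ℕ → Fin n → R) :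
    (Matrix.of fun j i => ∑ r ∈ S j, c j r * f j r i).det =
      ∑ r ∈ Fintype.piFinset S, (∏ j, c j (r j)) * (Matrix.of fun j i => f j (r j) i).det := by
  have h1 := (Matrix.detRowAlternating (n := Fin n) (R := R)).toMultilinearMap.map_sum_finset
    (fun j r => c j r • f j r) S
  have h2 : (fun j => ∑ r ∈ S j, c j r • f j r) =
      Matrix.of fun j i => ∑ r ∈ S j, c j r * f j r i := by
    ext j i
    simp [Finset.sum_apply]
  rw [h2] at h1
  refine h1.trans (Finset.sum_congr rfl fun r _ => ?_)
  exact MultilinearMap.map_smul_univ _ (fun j => c j (r j)) fun j => f j (r j)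

theorem geom_sum_interval {R : Type*} [CommRing R] (x w : R) {a b : ℕ} (h : b ≤ a) :
    (w - x) * ∑ r ∈ Finset.Icc b a, x ^ (a - r) * w ^ r = w ^ (a + 1) - x ^ (a + 1 - b) * w ^ b := by
  induction a, h using Nat.le_induction with
  | base =>
    have : b + 1 - b = 1 := by omega
    simp [this]; ring
  | succ a h ih =>
    rw [Finset.sum_Icc_succ_top (by omega), mul_add]
    have h1 : ∑ r ∈ Finset.Icc b a, x ^ (a + 1 - r) * w ^ r =
        x * ∑ r ∈ Finset.Icc b a, x ^ (a - r) * w ^ r := by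
      rw [Finset.mul_sum]
      refine Finset.sum_congr rfl fun r hr => ?_
      rw [Finset.mem_Icc] at hr
      have : a + 1 - r = (a - r) + 1 := by omega
      rw [this]; ring
    have h2 : a + 1 + 1 - b = (a + 1 - b) + 1 := by omega
    rw [h1, mul_left_comm, ih, h2]
    simp
    ring

/-- The numerator `det [v_i ^ (mu_j + n - j)]` of the Schur polynomial. -/
def alternant {R : Type*} [CommRing R] {n : ℕ} (v : Fin n → R) (mu : ℕ → ℕ) : R :=
  (Matrix.of fun j i : Fin n => v i ^ (mu j + (n - 1 - j))).det

/-- The branching rule of the alternants. -/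
theorem alternant_succ {R : Type*} [CommRing R] {n : ℕ} (v : Fin (n + 1) → R) {mu : ℕ → ℕ}
    (hmu : Antitone mu) :
    alternant v mu = (∏ i : Fin n, (v 0 - v i.succ)) *
      ∑ r ∈ Fintype.piFinset fun j : Fin n => Finset.Icc (mu (j + 1)) (mu j),
        v 0 ^ (mu n + ∑ j : Fin n, (mu j - r j)) *
          (Matrix.of fun j i : Fin n => v i.succ ^ (r j + (n - 1 - j))).det := by
  -- Subtract from each row a multiple of the next one, so that the column of `v 0` has a single
  -- nonzero entry.
  set M : Matrix (Fin (n + 1)) (Fin (n + 1)) R :=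
    Matrix.of fun j i => v i ^ (mu j + (n + 1 - 1 - j)) with hM
  set M' : Matrix (Fin (n + 1)) (Fin (n + 1)) R := Matrix.of fun j i =>
    if (j : ℕ) = n then v i ^ mu n else v i ^ (mu j + (n - j)) -
      v 0 ^ (mu j + 1 - mu (j + 1)) * v i ^ (mu (j + 1) + (n - (j + 1))) with hM'
  have h1 : M.det = M'.det := by
    rw [← Matrix.det_submatrix_equiv_self Fin.revPerm M,
      ← Matrix.det_submatrix_equiv_self Fin.revPerm M']
    refine Matrix.det_eq_of_forall_row_eq_smul_add_pred
      (fun j => v 0 ^ (mu j.rev + 1 - mu (j.rev + 1))) (fun i => ?_) fun j i => ?_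
    · simp [hM, hM']
    · have h2 : (j.rev : ℕ) ≠ n := by have := j.rev.isLt; omega
      simp only [hM, hM', Matrix.submatrix_apply, Fin.revPerm_apply, Fin.rev_succ,
        Fin.rev_castSucc, Matrix.of_apply, Fin.val_castSucc, Fin.val_succ, if_neg h2]
      simp
  have h2 : M'.det = (-1) ^ n * v 0 ^ mu n *
      (Matrix.of fun j i : Fin n => M' j.castSucc i.succ).det := by
    rw [Matrix.det_succ_column_zero, Finset.sum_eq_single (Fin.last n)]
    · simp only [Fin.val_last, hM', Matrix.of_apply, if_true]
      congr 2
      ext j i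
      simp [Fin.succAbove_last]
    · intro j _ hj
      have hj' : (j : ℕ) ≠ n := fun h => hj (Fin.ext h)
      have hlt := j.isLt
      have h3 := hmu (Nat.le_add_right (j : ℕ) 1)
      have : M' j 0 = 0 := by
        simp only [hM', Matrix.of_apply, if_neg hj', ← pow_add]
        rw [sub_eq_zero]
        congr 1
        omega
      simp [this]
    · simp
  have h3 : (Matrix.of fun j i : Fin n => M' j.castSucc i.succ) =
      Matrix.of fun j i : Fin n => (v i.succ - v 0) * (Matrix.of fun j i : Fin n =>
        ∑ r ∈ Finset.Icc (mu (j + 1)) (mu j), v 0 ^ (mu j - r) * v i.succ ^ (r + (n - 1 - j))) j i := by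
    ext j i
    have hj : (j : ℕ) ≠ n := by omega
    simp only [hM', Matrix.of_apply, Fin.val_castSucc, if_neg hj]
    have h4 : ∀ r, v 0 ^ (mu j - r) * v i.succ ^ (r + (n - 1 - j)) =
        v 0 ^ (mu j - r) * v i.succ ^ r * v i.succ ^ (n - 1 - j) := fun r => by ring
    simp only [h4]
    rw [← Finset.sum_mul, ← mul_assoc, geom_sum_interval _ _ (hmu (Nat.le_add_right _ 1)), sub_mul,
      mul_assoc, ← pow_add, ← pow_add]
    have h5 : mu j + (n - j) = mu j + 1 + (n - 1 - j) := by omega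
    have h6 : n - (j + 1) = n - 1 - (j : ℕ) := by omega
    rw [h5, h6]
  have h4 : (-1) ^ n * ∏ i : Fin n, (v i.succ - v 0) = ∏ i : Fin n, (v 0 - v i.succ) := by
    have : ∏ i : Fin n, (v 0 - v i.succ) = ∏ i : Fin n, (-1) * (v i.succ - v 0) :=
      Finset.prod_congr rfl fun i _ => by ring
    rw [this, Finset.prod_mul_distrib]
    simp
  have h5 : alternant v mu = M.det := rfl
  rw [h5, h1, h2, h3, Matrix.det_mul_row, det_sum_rows, ← h4]
  simp only [Finset.mul_sum, pow_add, ← Finset.prod_pow_eq_pow_sum]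
  refine Finset.sum_congr rfl fun r _ => ?_
  ring

theorem vandermondeProd_succ {R : Type*} [CommRing R] {n : ℕ} (v : Fin (n + 1) → R) :
    vandermondeProd v = (∏ i : Fin n, (v 0 - v i.succ)) * vandermondeProd fun i => v i.succ := by
  simp [vandermondeProd, Fin.prod_univ_succ, Fin.prod_Ioi_succ]

/-- Extension of a finite sequence by zero. -/
def extendZero {n : ℕ} (r : Fin n → ℕ) (i : ℕ) : ℕ := if h : i < n then r ⟨i, h⟩ else 0

@[simp] theorem extendZero_fin {n : ℕ} (r : Fin n → ℕ) (i : Fin n) : extendZero r i = r i := by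
  simp [extendZero]

theorem extendZero_of_le {n : ℕ} (r : Fin n → ℕ) {i : ℕ} (h : n ≤ i) : extendZero r i = 0 := by
  simp [extendZero, not_lt.2 h]

theorem extendZero_restrict {n : ℕ} {mu : ℕ → ℕ} (h : ∀ i, n ≤ i → mu i = 0) :
    extendZero (fun i : Fin n => mu i) = mu := by
  funext i
  by_cases hi : i < n
  · simp [extendZero, hi]
  · simp [extendZero, hi, h i (not_lt.1 hi)]

theorem extendZero_injective {n : ℕ} : Function.Injective (extendZero : (Fin n → ℕ) → ℕ → ℕ) := by
  intro r s h
  funext i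
  have := congrFun h i
  simpa using this

theorem size_extendZero {n N : ℕ} (h : n ≤ N) (r : Fin n → ℕ) : size N (extendZero r) = ∑ j, r j := by
  rw [size_eq_of_le h fun i hi => extendZero_of_le r hi, size, Finset.sum_range]
  simp

/-- The sum over interlacing arrays is the quotient of alternants. -/
theorem vandermondeProd_mul_schurSum {R : Type*} [CommRing R] (N : ℕ) (z : ℕ → R) {n : ℕ}
    (hn : n ≤ N) {mu : ℕ → ℕ} (hmu : Antitone mu) (h0 : ∀ i, n ≤ i → mu i = 0) :
    vandermondeProd (fun i : Fin n => z (n - 1 - i)) * schurSum N z n mu =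
      alternant (fun i : Fin n => z (n - 1 - i)) mu := by
  induction n generalizing mu with
  | zero =>
    have : mu = 0 := funext fun i => h0 i (Nat.zero_le i)
    simp [vandermondeProd, alternant, schurSum, chainSum, this]
  | succ n ih =>
    have hz : ∀ i : Fin n, z (n + 1 - 1 - i.succ) = z (n - 1 - i) := fun i => by
      congr 1
      simp; omega
    rw [vandermondeProd_succ, alternant_succ _ hmu, mul_assoc]
    congr 1
    simp only [hz]
    rw [schurSum_succ, Finset.mul_sum]
    symm
    have hsz : size N mu = ∑ j : Fin n, mu j + mu n := by
      rw [size_eq_of_le hn h0, size, Finset.sum_range_succ, Finset.sum_range]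
    refine Finset.sum_of_injOn extendZero extendZero_injective.injOn ?_ ?_ ?_
    · intro r hr
      simp only [Finset.mem_coe, Fintype.mem_piFinset, Finset.mem_Icc] at hr
      have hI : Interlace (extendZero r) mu := by
        intro i
        by_cases hi : i < n
        · simpa [extendZero, hi] using hr ⟨i, hi⟩
        · rw [extendZero_of_le r (by omega), h0 (i + 1) (by omega)]
          simp
      rw [Finset.mem_coe, mem_below]
      exact ⟨hI.antitone_left, hI, fun i hi => extendZero_of_le r (by omega)⟩
    · intro nu hnu hnu'
      obtain ⟨-, h1, -⟩ := mem_below.1 hnu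
      by_cases h2 : ∃ i, n ≤ i ∧ nu i ≠ 0
      · obtain ⟨i, hi, h3⟩ := h2
        rw [schurSum_eq_zero N z hi h3]
        simp
      · push Not at h2
        refine absurd ⟨fun i : Fin n => nu i, ?_, extendZero_restrict h2⟩ hnu'
        simp only [Finset.mem_coe, Fintype.mem_piFinset, Finset.mem_Icc]
        exact fun i => h1 i
    · intro r hr
      simp only [Fintype.mem_piFinset, Finset.mem_Icc] at hr
      have hI : Antitone (extendZero r) := by
        refine antitone_nat_of_succ_le fun i => ?_
        by_cases hi : i + 1 < n
        · have h1 := (hr ⟨i, by omega⟩).1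
          have h2 := (hr ⟨i + 1, hi⟩).2
          have h3 : i < n := by omega
          simp only [extendZero, hi, h3, dif_pos]
          exact h2.trans h1
        · rw [extendZero_of_le r (by omega)]
          exact Nat.zero_le _
      have h4 := ih (by omega) hI fun i hi => extendZero_of_le r hi
      simp only [alternant, extendZero_fin] at h4
      rw [mul_left_comm, h4, hsz, size_extendZero (by omega)]
      congr 1
      · simp only [Fin.val_zero, Nat.sub_zero, Nat.add_sub_cancel]
        congr 1
        have h5 : ∑ j : Fin n, (mu j - r j) + ∑ j, r j = ∑ j : Fin n, mu j := by
          rw [← Finset.sum_add_distrib]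
          exact Finset.sum_congr rfl fun j _ => Nat.sub_add_cancel (hr j).2
        omega

/-! ### Chains of vertical strips with prescribed rows -/

section Vertical

variable {R : Type*} [CommRing R] (N : ℕ) (u : R) (lam : ℕ → ℕ)

open Classical in
/-- The weighted chains of `s` vertical strips in which row `N - 1 - s` is prescribed after step
`s`. -/
noncomputable def diagSum (F : (ℕ → ℕ) → R) : ℕ → (ℕ → ℕ) → R :=
  chainSum N (fun _ => true) (fun _ => u) (fun s mu => mu (N - 1 - s) = lam (N - 1 - s))
    fun mu => if mu (N - 1) = lam (N - 1) then F mu else 0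

open Classical in
/-- The part of `diagSum` that moves each row until the step at which it is prescribed. -/
noncomputable def beforeSum (F : (ℕ → ℕ) → R) : ℕ → (ℕ → ℕ) → R :=
  chainSum N (fun _ => true) (fun _ => u) (fun s mu => ∀ i, N - 1 - s ≤ i → mu i = lam i)
    fun mu => if ∀ i, N - 1 ≤ i → mu i = lam i then F mu else 0

open Classical in
/-- The part of `diagSum` that moves each row after the step at which it is prescribed. -/
noncomputable def afterSum : ℕ → (ℕ → ℕ) → R :=
  chainSum N (fun _ => true) (fun _ => u) (fun s mu => ∀ i ≤ N - 1 - s, mu i = lam i)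
    fun mu => if ∀ i ≤ N - 1, mu i = lam i then 1 else 0

variable {N u lam}

theorem diagSum_eq_zero {F : (ℕ → ℕ) → R} {s : ℕ} {mu : ℕ → ℕ}
    (h : mu (N - 1 - s) ≠ lam (N - 1 - s)) : diagSum N u lam F s mu = 0 := by
  cases s with
  | zero => exact if_neg h
  | succ s => exact if_neg h

theorem beforeSum_eq_zero {F : (ℕ → ℕ) → R} {s : ℕ} {mu : ℕ → ℕ}
    (h : ¬ ∀ i, N - 1 - s ≤ i → mu i = lam i) : beforeSum N u lam F s mu = 0 := by
  cases s with
  | zero => exact if_neg h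
  | succ s => exact if_neg h

theorem afterSum_eq_zero {s : ℕ} {mu : ℕ → ℕ} (h : ¬ ∀ i ≤ N - 1 - s, mu i = lam i) :
    afterSum N u lam s mu = 0 := by
  cases s with
  | zero => exact if_neg h
  | succ s => exact if_neg h

theorem diagSum_succ {F : (ℕ → ℕ) → R} {s : ℕ} {mu : ℕ → ℕ}
    (h : mu (N - 1 - (s + 1)) = lam (N - 1 - (s + 1))) : diagSum N u lam F (s + 1) mu =
      ∑ nu ∈ below true N mu, u ^ (size N mu - size N nu) * diagSum N u lam F s nu :=
  if_pos h

theorem beforeSum_succ {F : (ℕ → ℕ) → R} {s : ℕ} {mu : ℕ → ℕ}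
    (h : ∀ i, N - 1 - (s + 1) ≤ i → mu i = lam i) : beforeSum N u lam F (s + 1) mu =
      ∑ nu ∈ below true N mu, u ^ (size N mu - size N nu) * beforeSum N u lam F s nu :=
  if_pos h

theorem afterSum_succ {s : ℕ} {mu : ℕ → ℕ}
    (h : ∀ i ≤ N - 1 - (s + 1), mu i = lam i) : afterSum N u lam (s + 1) mu =
      ∑ nu ∈ below true N mu, u ^ (size N mu - size N nu) * afterSum N u lam s nu :=
  if_pos h

/-- The sequence that agrees with `a` up to index `q` and with `b` from then on. -/
def splice (q : ℕ) (a b : ℕ → ℕ) (i : ℕ) : ℕ := if i ≤ q then a i else b i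

theorem splice_antitone {q : ℕ} {a b : ℕ → ℕ} (ha : Antitone a) (hb : Antitone b)
    (h : a q = b q) : Antitone (splice q a b) := by
  refine antitone_nat_of_succ_le fun i => ?_
  have h1 := ha (Nat.le_add_right i 1)
  have h2 := hb (Nat.le_add_right i 1)
  unfold splice
  split_ifs with h3 h4 h4
  · exact h1
  · omega
  · obtain rfl : i = q := by omega
    omega
  · exact h2

theorem size_splice_add (q : ℕ) (a b : ℕ → ℕ) :
    size N (splice q a b) + size N (splice q b a) = size N a + size N b := by
  simp only [size, ← Finset.sum_add_distrib]
  refine Finset.sum_congr rfl fun i _ => ?_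
  unfold splice
  split_ifs <;> omega

/-- At step `s` the row `q = N - 1 - s` separates the rows that are still to be prescribed from those
that already are, so that the sum over chains factors. -/
theorem diagSum_eq_mul {F : (ℕ → ℕ) → R} (hlam : Antitone lam) (hl0 : ∀ i, N ≤ i → lam i = 0)
    {s : ℕ} (hs : s + 1 ≤ N) {mu : ℕ → ℕ} (hmu : Antitone mu) (hm0 : ∀ i, N ≤ i → mu i = 0)
    (hq : mu (N - 1 - s) = lam (N - 1 - s)) :
    diagSum N u lam F s mu = beforeSum N u lam F s (splice (N - 1 - s) mu lam) *
      afterSum N u lam s (splice (N - 1 - s) lam mu) := by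
  induction s generalizing mu with
  | zero =>
    have h1 : splice (N - 1 - 0) mu lam = mu := by
      funext i
      simp only [splice]
      split_ifs with h
      · rfl
      · rw [hm0 i (by omega), hl0 i (by omega)]
    have h2 : ∀ i, N - 1 ≤ i → mu i = lam i := by
      intro i hi
      rcases Nat.eq_or_lt_of_le hi with rfl | hi
      · exact hq
      · rw [hm0 i (by omega), hl0 i (by omega)]
    rw [h1]
    have h3 : diagSum N u lam F 0 mu = F mu := if_pos hq
    have h4 : beforeSum N u lam F 0 mu = F mu := if_pos h2
    have h5 : afterSum N u lam 0 (splice (N - 1 - 0) lam mu) = 1 :=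
      if_pos fun i hi => if_pos hi
    rw [h3, h4, h5, mul_one]
  | succ s ih =>
    obtain ⟨q, hq1⟩ : ∃ q, N - 1 - (s + 1) = q := ⟨_, rfl⟩
    have hq2 : N - 1 - s = q + 1 := by omega
    rw [diagSum_succ hq, beforeSum_succ, afterSum_succ]
    rotate_left
    · intro i hi
      exact if_pos hi
    · intro i hi
      simp only [splice]
      split_ifs with h
      · obtain rfl : i = N - 1 - (s + 1) := by omega
        exact hq
      · rfl
    rw [hq1] at hq ⊢
    rw [hq2] at ih
    have hb : ∀ β, beforeSum N u lam F s β ≠ 0 → ∀ i, q + 1 ≤ i → β i = lam i := by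
      intro β h
      by_contra h'
      exact h (beforeSum_eq_zero (by rwa [hq2]))
    have ha : ∀ α, afterSum N u lam s α ≠ 0 → ∀ i ≤ q + 1, α i = lam i := by
      intro β h
      by_contra h'
      exact h (afterSum_eq_zero (by rwa [hq2]))
    rw [Finset.sum_mul_sum, ← Finset.sum_product',
      ← Finset.sum_filter_of_ne (p := fun nu => nu (q + 1) = lam (q + 1))]
    swap
    · intro nu _ h
      by_contra h'
      exact h (by rw [diagSum_eq_zero (by rwa [hq2]), mul_zero])
    refine Finset.sum_of_injOn (fun nu => (splice (q + 1) nu lam, splice (q + 1) lam nu))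
      ?_ ?_ ?_ ?_
    · intro nu _ nu' _ h
      rw [Prod.mk.injEq] at h
      funext i
      have h1 := congrFun h.1 i
      have h2 := congrFun h.2 i
      simp only [splice] at h1 h2
      split_ifs at h1 h2
      · exact h1
      · exact h2
    · intro nu hnu
      rw [Finset.mem_coe, Finset.mem_filter, mem_below] at hnu
      obtain ⟨⟨h1, h2, h3⟩, h4⟩ := hnu
      rw [Finset.mem_coe, Finset.mem_product, mem_below, mem_below]
      refine ⟨⟨splice_antitone h1 hlam h4, fun i => ?_, fun i hi => ?_⟩,
        splice_antitone hlam h1 h4.symm, fun i => ?_, fun i hi => ?_⟩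
      · have h5 := h2 i
        simp only [splice]
        split_ifs with h6 h7 h7
        · exact h5
        · obtain rfl : i = q + 1 := by omega
          omega
        · omega
        · omega
      · have h5 := h3 i hi
        have h6 := hl0 i hi
        simp only [splice]
        split_ifs <;> assumption
      · have h5 := h2 i
        simp only [splice]
        split_ifs with h6 h7 h7
        · omega
        · obtain rfl : i = q + 1 := by omega
          omega
        · omega
        · exact h5
      · have h5 := h3 i hi
        have h6 := hl0 i hi
        simp only [splice]
        split_ifs <;> assumption
    · rintro ⟨β, α⟩ hβα hn
      rw [Finset.mem_product, mem_below, mem_below] at hβα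
      obtain ⟨⟨h1, h2, h3⟩, h4, h5, h6⟩ := hβα
      by_contra h
      have hβ := hb β fun h' => h (by simp [h'])
      have hα := ha α fun h' => h (by simp [h'])
      have h7 : β (q + 1) = α (q + 1) := by rw [hβ _ le_rfl, hα _ le_rfl]
      refine hn ⟨splice (q + 1) β α, ?_, ?_⟩
      · rw [Finset.mem_coe, Finset.mem_filter, mem_below]
        refine ⟨⟨splice_antitone h1 h4 h7, fun i => ?_, fun i hi => ?_⟩, ?_⟩
        · have h8 := h2 i
          have h9 := h5 i
          simp only [splice] at *
          split_ifs at h8 h9 ⊢ with h10 h11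
          · exact h8
          · obtain rfl : i = q + 1 := by omega
            omega
          · omega
          · exact h9
        · have h8 := h3 i hi
          have h9 := h6 i hi
          simp only [splice]
          split_ifs <;> assumption
        · rw [splice, if_pos le_rfl, hβ _ le_rfl]
      · refine Prod.ext (funext fun i => ?_) (funext fun i => ?_)
        · have h8 := hβ i
          dsimp only
          simp only [splice]
          split_ifs
          · rfl
          · exact (h8 (by omega)).symm
        · have h8 := hα i
          dsimp only
          simp only [splice]
          split_ifs
          · exact (h8 (by omega)).symm
          · rfl
    · intro nu hnu
      rw [Finset.mem_filter, mem_below] at hnu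
      obtain ⟨⟨h1, h2, h3⟩, h4⟩ := hnu
      rw [ih (by omega) h1 h3 h4]
      have h5 : size N nu ≤ size N mu := size_mono fun i => h2.le i
      have h6 : size N (splice (q + 1) nu lam) ≤ size N (splice q mu lam) := by
        refine size_mono fun i => ?_
        have := h2.le i
        simp only [splice]
        split_ifs with h6 h7
        · exact this
        · obtain rfl : i = q + 1 := by omega
          exact h4.le
        · omega
        · omega
      have h7 : size N (splice (q + 1) lam nu) ≤ size N (splice q lam mu) := by
        refine size_mono fun i => ?_
        have := h2.le i
        simp only [splice]
        split_ifs with h6 h7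
        · exact le_rfl
        · obtain rfl : i = q + 1 := by omega
          exact h4 ▸ this
        · omega
        · exact this
      have h8 := size_splice_add (N := N) q mu lam
      have h9 := size_splice_add (N := N) (q + 1) nu lam
      have h10 : size N mu - size N nu =
          (size N (splice q mu lam) - size N (splice (q + 1) nu lam)) +
          (size N (splice q lam mu) - size N (splice (q + 1) lam nu)) := by omega
      rw [h10, pow_add]
      ring

end Vertical

/-! ### Determinants for chains of vertical strips -/

section Determinants

variable {R : Type*} [CommRing R] {N : ℕ} {u : R} {lam : ℕ → ℕ}

/-- The determinant that evaluates the sum over the chains that prescribe the rows below row `q`. -/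
def beforeDet (u : R) (q : ℕ) (v : Fin N → R) (mu : ℕ → ℕ) : R :=
  (Matrix.of fun j i : Fin N =>
    v i ^ (mu j + (max q j - j)) * (v i + u) ^ (N - 1 - max q j)).det

/-- The determinant that evaluates the sum over the chains that prescribe the rows above row `q`. -/
def afterDet (u : R) (q : ℕ) (v : Fin N → R) (mu : ℕ → ℕ) : R :=
  (Matrix.of fun j i : Fin N =>
    v i ^ (mu j + (N - 1 - j)) * (1 + u * v i) ^ (min j q : ℕ)).det

theorem sum_range_two {M : Type*} [AddCommMonoid M] (f : ℕ → M) :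
    ∑ e ∈ Finset.range 2, f e = f 0 + f 1 := by
  simp [Finset.sum_range_succ]

theorem mem_piFinset_range {S : Fin N → ℕ} {e : Fin N → ℕ} :
    e ∈ Fintype.piFinset (fun j => Finset.range (S j)) ↔ ∀ j, e j < S j := by
  simp

open Classical in
theorem beforeDet_eq_sum {q : ℕ} (hq : q + 1 < N) (v : Fin N → R) {mu : ℕ → ℕ} (hmu : Antitone mu)
    (hm0 : ∀ i, N ≤ i → mu i = 0) :
    beforeDet u q v mu =
      ∑ nu ∈ (below true N mu).filter (fun nu => ∀ i, q + 1 ≤ i → nu i = mu i),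
        u ^ (size N mu - size N nu) * beforeDet u (q + 1) v nu := by
  have h1 : beforeDet u q v mu = (Matrix.of fun j i : Fin N =>
      ∑ e ∈ Finset.range (if (j : ℕ) ≤ q then 2 else 1), u ^ e *
        (v i ^ (mu j + (max (q + 1) j - j) - e) * (v i + u) ^ (N - 1 - max (q + 1) j))).det := by
    unfold beforeDet
    congr 1
    ext j i
    simp only [Matrix.of_apply]
    split_ifs with hj
    · have e1 : max q (j : ℕ) = q := by omega
      have e2 : max (q + 1) (j : ℕ) = q + 1 := by omega
      have e3 : mu j + (q + 1 - j) - 0 = mu j + (q - j) + 1 := by omega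
      have e4 : mu j + (q + 1 - j) - 1 = mu j + (q - j) := by omega
      have e5 : N - 1 - q = N - 1 - (q + 1) + 1 := by omega
      rw [sum_range_two, e1, e2, e3, e4, e5]
      ring
    · have e1 : max q (j : ℕ) = j := by omega
      have e2 : max (q + 1) (j : ℕ) = j := by omega
      simp [e1, e2]
  rw [h1, det_sum_rows]
  symm
  refine Finset.sum_of_injOn (fun nu (j : Fin N) => mu j - nu j) ?_ ?_ ?_ ?_
  · intro nu hnu nu' hnu' h
    rw [Finset.mem_coe, Finset.mem_filter, mem_below] at hnu hnu'
    funext i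
    by_cases hi : i < N
    · have h2 := congrFun h ⟨i, hi⟩
      have h3 := hnu.1.2.1.le i
      have h4 := hnu'.1.2.1.le i
      dsimp only at h2
      omega
    · rw [hnu.1.2.2 i (by omega), hnu'.1.2.2 i (by omega)]
  · intro nu hnu
    rw [Finset.mem_coe, Finset.mem_filter, mem_below] at hnu
    rw [Finset.mem_coe, mem_piFinset_range]
    intro j
    have h2 := hnu.1.2.1 j
    have h3 := hnu.2 j
    dsimp only
    split_ifs
    · omega
    · rw [h3 (by omega)]; omega
  · intro e he hn
    rw [mem_piFinset_range] at he
    have hE : ∀ i, extendZero e i ≤ 1 ∧ (q < i → extendZero e i = 0) := by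
      intro i
      by_cases hi : i < N
      · have := he ⟨i, hi⟩
        dsimp only at this
        simp only [extendZero, hi, dif_pos]
        split_ifs at this <;> omega
      · simp [extendZero, hi]
    obtain ⟨j, hj⟩ : ∃ j, mu j + extendZero e (j + 1) < mu (j + 1) + extendZero e j := by
      by_contra! h
      have hle : ∀ d i, N ≤ i + d → extendZero e i ≤ mu i := by
        intro d
        induction d with
        | zero => intro i hi; rw [extendZero_of_le e (by omega)]; exact Nat.zero_le _
        | succ d ih =>
          intro i hi
          have h2 := ih (i + 1) (by omega)
          have h3 := h i
          omega
      have hle' : ∀ i, extendZero e i ≤ mu i := fun i => hle N i (by omega)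
      refine hn ⟨fun i => mu i - extendZero e i, ?_, ?_⟩
      · rw [Finset.mem_coe, Finset.mem_filter, mem_below]
        refine ⟨⟨antitone_nat_of_succ_le fun i => ?_, fun i => ?_, fun i hi => ?_⟩,
          fun i hi => ?_⟩
        · have := h i
          have := hle' i
          have := hle' (i + 1)
          omega
        · have := hE i
          dsimp only
          omega
        · simp [hm0 i hi]
        · simp [(hE i).2 (by omega)]
      · funext j
        have := hle' j
        simp only [extendZero_fin] at this ⊢
        omega
    -- The moved rows `j` and `j + 1` collide, so that two rows of the determinant agree.
    have h2 := hmu (Nat.le_add_right j 1)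
    have h3 := hE j
    have h4 := hE (j + 1)
    have hjq : j ≤ q := by
      by_contra h
      have := h3.2 (by omega)
      omega
    have hj1 : j < N := by omega
    have hj2 : j + 1 < N := by omega
    have e1 : e ⟨j, hj1⟩ = 1 := by
      have : extendZero e j = 1 := by omega
      simpa [extendZero, hj1] using this
    have e2 : e ⟨j + 1, hj2⟩ = 0 := by
      have : extendZero e (j + 1) = 0 := by omega
      simpa [extendZero, hj2] using this
    rw [Matrix.det_zero_of_row_eq (i := ⟨j, hj1⟩) (j := ⟨j + 1, hj2⟩) (by simp), mul_zero]
    funext i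
    have e3 : max (q + 1) j = q + 1 := by omega
    have e4 : max (q + 1) (j + 1) = q + 1 := by omega
    simp only [Matrix.of_apply, e1, e2, e3, e4]
    congr 2
    omega
  · intro nu hnu
    rw [Finset.mem_filter, mem_below] at hnu
    obtain ⟨⟨-, h2, h3⟩, h4⟩ := hnu
    have h5 : ∑ j : Fin N, (mu j - nu j) = size N mu - size N nu := by
      have : ∑ j : Fin N, (mu j - nu j) + ∑ j : Fin N, nu j = ∑ j : Fin N, mu j := by
        rw [← Finset.sum_add_distrib]
        exact Finset.sum_congr rfl fun j _ => Nat.sub_add_cancel (h2.le j)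
      simp only [size, Finset.sum_range]
      omega
    rw [Finset.prod_pow_eq_pow_sum, h5]
    congr 1
    unfold beforeDet
    congr 1
    ext j i
    simp only [Matrix.of_apply]
    congr 2
    have := h2.le j
    omega

/-- The shapes with at most `N` rows that agree with `lam` in the rows up to `q`. -/
noncomputable def fixedAbove (N q : ℕ) (lam : ℕ → ℕ) : Finset (ℕ → ℕ) :=
  Set.Finite.toFinset (s := {nu | Antitone nu ∧ (∀ i, N ≤ i → nu i = 0) ∧ ∀ i ≤ q, nu i = lam i}) <| by
    refine ((Fintype.piFinset fun _ : Fin N => Finset.range (lam 0 + 1)).finite_toSet.image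
      extendZero).subset ?_
    rintro nu ⟨h1, h2, h3⟩
    refine ⟨fun i => nu i, ?_, extendZero_restrict h2⟩
    simp only [Finset.mem_coe, Fintype.mem_piFinset, Finset.mem_range]
    intro i
    rw [← h3 0 (Nat.zero_le q)]
    exact Nat.lt_succ_of_le (h1 (Nat.zero_le i))

theorem mem_fixedAbove {q : ℕ} {nu : ℕ → ℕ} :
    nu ∈ fixedAbove N q lam ↔
      Antitone nu ∧ (∀ i, N ≤ i → nu i = 0) ∧ ∀ i ≤ q, nu i = lam i := by
  simp [fixedAbove]

open Classical in
theorem afterDet_eq_sum {q : ℕ} (v : Fin N → R) {mu : ℕ → ℕ}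
    (hmu : mu ∈ fixedAbove N (q + 1) lam) :
    afterDet u (q + 1) v mu =
      ∑ nu ∈ (fixedAbove N q lam).filter (fun nu => mu ∈ below true N nu),
        u ^ (size N nu - size N mu) * afterDet u q v nu := by
  obtain ⟨hmu, hm0, hml⟩ := mem_fixedAbove.1 hmu
  have h1 : afterDet u (q + 1) v mu = (Matrix.of fun j i : Fin N =>
      ∑ e ∈ Finset.range (if (j : ℕ) ≤ q then 1 else 2), u ^ e *
        (v i ^ (mu j + e + (N - 1 - j)) * (1 + u * v i) ^ (min j q : ℕ))).det := by
    unfold afterDet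
    congr 1
    ext j i
    simp only [Matrix.of_apply]
    split_ifs with hj
    · have e1 : min (j : ℕ) q = j := by omega
      have e2 : min (j : ℕ) (q + 1) = j := by omega
      simp [e1, e2]
    · have e1 : min (j : ℕ) q = q := by omega
      have e2 : min (j : ℕ) (q + 1) = q + 1 := by omega
      rw [sum_range_two, e1, e2]
      ring
  rw [h1, det_sum_rows]
  symm
  refine Finset.sum_of_injOn (fun nu (j : Fin N) => nu j - mu j) ?_ ?_ ?_ ?_
  · intro nu hnu nu' hnu' h
    rw [Finset.mem_coe, Finset.mem_filter, mem_below, mem_fixedAbove] at hnu hnu'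
    funext i
    by_cases hi : i < N
    · have h2 := congrFun h ⟨i, hi⟩
      have h3 := hnu.2.2.1.le i
      have h4 := hnu'.2.2.1.le i
      dsimp only at h2
      omega
    · rw [hnu.1.2.1 i (by omega), hnu'.1.2.1 i (by omega)]
  · intro nu hnu
    rw [Finset.mem_coe, Finset.mem_filter, mem_below, mem_fixedAbove] at hnu
    rw [Finset.mem_coe, mem_piFinset_range]
    intro j
    have h2 := hnu.2.2.1 j
    have h3 := hnu.1.2.2 j
    have h4 := hml j
    dsimp only
    split_ifs
    · rw [h3 (by omega), h4 (by omega)]; omega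
    · omega
  · intro e he hn
    rw [mem_piFinset_range] at he
    have hE : ∀ i, extendZero e i ≤ 1 ∧ (i ≤ q → extendZero e i = 0) := by
      intro i
      by_cases hi : i < N
      · have := he ⟨i, hi⟩
        dsimp only at this
        simp only [extendZero, hi, dif_pos]
        split_ifs at this <;> omega
      · simp [extendZero, hi]
    obtain ⟨j, hj⟩ : ∃ j, mu j + extendZero e j < mu (j + 1) + extendZero e (j + 1) := by
      by_contra! h
      refine hn ⟨fun i => mu i + extendZero e i, ?_, ?_⟩
      · rw [Finset.mem_coe, Finset.mem_filter, mem_below, mem_fixedAbove]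
        refine ⟨⟨antitone_nat_of_succ_le h, fun i hi => ?_, fun i hi => ?_⟩,
          hmu, fun i => ?_, hm0⟩
        · simp [hm0 i hi, extendZero_of_le e hi]
        · simp [(hE i).2 hi, hml i (by omega)]
        · have := hE i
          dsimp only
          omega
      · funext j
        simp
    -- The moved rows `j` and `j + 1` collide, so that two rows of the determinant agree.
    have h2 := hmu (Nat.le_add_right j 1)
    have h3 := hE j
    have h4 := hE (j + 1)
    have hjq : q ≤ j := by
      by_contra h
      have := h4.2 (by omega)
      omega
    have hj2 : j + 1 < N := by
      by_contra h
      have := extendZero_of_le e (i := j + 1) (by omega)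
      omega
    have hj1 : j < N := by omega
    have e1 : e ⟨j, hj1⟩ = 0 := by
      have : extendZero e j = 0 := by omega
      simpa [extendZero, hj1] using this
    have e2 : e ⟨j + 1, hj2⟩ = 1 := by
      have : extendZero e (j + 1) = 1 := by omega
      simpa [extendZero, hj2] using this
    rw [Matrix.det_zero_of_row_eq (i := ⟨j, hj1⟩) (j := ⟨j + 1, hj2⟩) (by simp), mul_zero]
    funext i
    have e3 : min j q = q := by omega
    have e4 : min (j + 1) q = q := by omega
    simp only [Matrix.of_apply, e1, e2, e3, e4]
    congr 2
    omega
  · intro nu hnu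
    rw [Finset.mem_filter, mem_below] at hnu
    have h2 := hnu.2.2.1
    have h5 : ∑ j : Fin N, (nu j - mu j) = size N nu - size N mu := by
      have : ∑ j : Fin N, (nu j - mu j) + ∑ j : Fin N, mu j = ∑ j : Fin N, nu j := by
        rw [← Finset.sum_add_distrib]
        exact Finset.sum_congr rfl fun j _ => Nat.sub_add_cancel (h2.le j)
      simp only [size, Finset.sum_range]
      omega
    rw [Finset.prod_pow_eq_pow_sum, h5]
    congr 1
    unfold afterDet
    congr 1
    ext j i
    simp only [Matrix.of_apply]
    congr 2
    have := h2.le j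
    omega

open Classical in
/-- The chains that prescribe the rows from the bottom to the top sum up to a determinant. -/
theorem vandermondeProd_mul_beforeSum (y : ℕ → R) (hlam : ∀ i, N ≤ i → lam i = 0)
    {s : ℕ} (hs : s + 1 ≤ N) {mu : ℕ → ℕ} (hmu : Antitone mu)
    (hm : ∀ i, N - 1 - s ≤ i → mu i = lam i) :
    vandermondeProd (fun i : Fin N => y (N - 1 - i)) *
        beforeSum N u lam (schurSum N y N) s mu =
      beforeDet u (N - 1 - s) (fun i : Fin N => y (N - 1 - i)) mu := by
  have hm0 : ∀ i, N ≤ i → mu i = 0 := fun i hi => by rw [hm i (by omega), hlam i hi]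
  induction s generalizing mu with
  | zero =>
    have h1 : beforeSum N u lam (schurSum N y N) 0 mu = schurSum N y N mu := if_pos hm
    rw [h1, vandermondeProd_mul_schurSum N y le_rfl hmu hm0]
    unfold alternant beforeDet
    congr 1
    ext j i
    have e1 : max (N - 1 - 0) (j : ℕ) = N - 1 := by omega
    simp only [Matrix.of_apply, e1, Nat.sub_self, pow_zero, mul_one]
  | succ s ih =>
    obtain ⟨q, hq1⟩ : ∃ q, N - 1 - (s + 1) = q := ⟨_, rfl⟩
    have hq2 : N - 1 - s = q + 1 := by omega
    rw [beforeSum_succ hm]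
    rw [hq1] at hm ⊢
    rw [hq2] at ih
    rw [beforeDet_eq_sum (by omega) _ hmu hm0, Finset.mul_sum, Finset.sum_filter]
    refine Finset.sum_congr rfl fun nu hnu => ?_
    rw [mem_below] at hnu
    split_ifs with h
    · have h' : ∀ i, q + 1 ≤ i → nu i = lam i := fun i hi => by
        rw [h i hi, hm i (by omega)]
      rw [mul_left_comm, ih (by omega) hnu.1 h' hnu.2.2]
    · rw [beforeSum_eq_zero, mul_zero, mul_zero]
      rw [hq2]
      intro h'
      exact h fun i hi => by rw [h' i hi, hm i (by omega)]

open Classical in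
/-- The chains that move the prescribed rows sum up to a determinant. -/
theorem sum_afterDet_mul_afterSum (hlam : Antitone lam) (hl0 : ∀ i, N ≤ i → lam i = 0)
    (v : Fin N → R) {s : ℕ} (hs : s + 1 ≤ N) :
    ∑ nu ∈ fixedAbove N (N - 1 - s) lam, afterDet u (N - 1 - s) v nu * afterSum N u lam s nu =
      afterDet u (N - 1) v lam := by
  induction s with
  | zero =>
    have h1 : fixedAbove N (N - 1 - 0) lam = {lam} := by
      ext nu
      rw [mem_fixedAbove, Finset.mem_singleton]
      refine ⟨fun ⟨_, h2, h3⟩ => funext fun i => ?_, ?_⟩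
      · by_cases hi : i < N
        · exact h3 i (by omega)
        · rw [h2 i (by omega), hl0 i (by omega)]
      · rintro rfl
        exact ⟨hlam, hl0, fun _ _ => rfl⟩
    have h2 : afterSum N u lam 0 lam = 1 := if_pos fun _ _ => rfl
    rw [h1, Finset.sum_singleton, h2, mul_one, Nat.sub_zero]
  | succ s ih =>
    rw [← ih (by omega)]
    obtain ⟨q, hq1⟩ : ∃ q, N - 1 - (s + 1) = q := ⟨_, rfl⟩
    have hq2 : N - 1 - s = q + 1 := by omega
    rw [hq1, hq2]
    have h1 : ∀ nu ∈ fixedAbove N q lam, afterDet u q v nu * afterSum N u lam (s + 1) nu =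
        ∑ mu ∈ (below true N nu).filter (fun mu => ∀ i ≤ q + 1, mu i = lam i),
          u ^ (size N nu - size N mu) * afterDet u q v nu * afterSum N u lam s mu := by
      intro nu hnu
      rw [afterSum_succ (by rw [hq1]; exact (mem_fixedAbove.1 hnu).2.2), Finset.mul_sum,
        Finset.sum_filter]
      refine Finset.sum_congr rfl fun mu _ => ?_
      split_ifs with h
      · ring
      · rw [afterSum_eq_zero (by rwa [hq2])]
        ring
    rw [Finset.sum_congr rfl h1]
    rw [Finset.sum_comm' (t' := fixedAbove N (q + 1) lam)
      (s' := fun mu => (fixedAbove N q lam).filter (fun nu => mu ∈ below true N nu))]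
    · refine Finset.sum_congr rfl fun mu hmu => ?_
      rw [afterDet_eq_sum v hmu, Finset.sum_mul]
    · intro nu mu
      simp only [Finset.mem_filter, mem_below, mem_fixedAbove]
      tauto

end Determinants

/-! ### The Grothendieck polynomials as sums over chains -/

section Polynomials

variable {N : ℕ} {β : ℝ} {lam : ℕ → ℕ}

theorem vandermondeProd_X_ne_zero :
    vandermondeProd (MvPolynomial.X : Fin N → MvPolynomial (Fin N) ℝ) ≠ 0 := by
  refine Finset.prod_ne_zero_iff.2 fun i _ => Finset.prod_ne_zero_iff.2 fun j hj => ?_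
  rw [sub_ne_zero]
  intro h
  exact (Finset.mem_Ioi.1 hj).ne (MvPolynomial.X_injective h)

theorem eq_alternantQuotient {f : Fin N → Polynomial ℝ} {Q : MvPolynomial (Fin N) ℝ}
    (h : vandermondeProd MvPolynomial.X * Q = alternantDet f) : Q = alternantQuotient f :=
  mul_left_cancel₀ vandermondeProd_X_ne_zero (h.trans (alternantQuotient_spec f))

/-- The variables in reverse order, continued by zero. -/
noncomputable def revVars (N : ℕ) (k : ℕ) : MvPolynomial (Fin N) ℝ :=
  if h : N - 1 - k < N then MvPolynomial.X ⟨N - 1 - k, h⟩ else 0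

theorem revVars_apply (i : Fin N) : revVars N (N - 1 - i) = MvPolynomial.X i := by
  have h : N - 1 - (N - 1 - (i : ℕ)) = i := by omega
  simp [revVars, h]

theorem eval_revVars (hN : 1 ≤ N) (y : ℝ) (k : ℕ) :
    MvPolynomial.eval (fun _ => y) (revVars N k) = y := by
  have h : N - 1 - k < N := by omega
  simp [revVars, h]

theorem eval_schurSum (hN : 1 ≤ N) (y : ℝ) (t : ℕ) (mu : ℕ → ℕ) :
    MvPolynomial.eval (fun _ => y) (schurSum N (revVars N) t mu) =
      schurSum N (fun _ => y) t mu := by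
  unfold schurSum
  rw [map_chainSum]
  simp only [eval_revVars hN]
  congr 1
  funext nu
  split_ifs <;> simp

theorem beforeSum_eq_eval (hN : 1 ≤ N) (hlam : Antitone lam) (hl0 : ∀ i, N ≤ i → lam i = 0)
    (y : ℝ) :
    beforeSum N (-β) lam (schurSum N (fun _ => y) N) (N - 1) lam =
      MvPolynomial.eval (fun _ => y) (grothendieckGbar (N := N) β fun i => lam i) := by
  have h1 := vandermondeProd_mul_beforeSum (N := N) (u := MvPolynomial.C (-β)) (lam := lam)
    (revVars N) hl0 (s := N - 1) (by omega) hlam (fun _ _ => rfl)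
  simp only [revVars_apply] at h1
  have h2 : beforeDet (MvPolynomial.C (-β)) (N - 1 - (N - 1))
      (fun i : Fin N => (MvPolynomial.X i : MvPolynomial (Fin N) ℝ)) lam =
      alternantDet fun j => Polynomial.X ^ lam j *
        (Polynomial.X - Polynomial.C β) ^ (N - 1 - j.val) := by
    unfold beforeDet alternantDet
    rw [← Matrix.det_transpose]
    congr 1
    ext1 i j
    simp only [Matrix.transpose_apply, Matrix.of_apply, map_mul, map_pow, map_sub,
      Polynomial.aeval_X, Polynomial.aeval_C]
    have e1 : max (N - 1 - (N - 1)) (j : ℕ) = j := by omega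
    rw [e1, Nat.sub_self, Nat.add_zero, map_neg, ← sub_eq_add_neg]
    rfl
  rw [grothendieckGbar, ← eq_alternantQuotient (h1.trans h2)]
  unfold beforeSum
  rw [map_chainSum]
  simp only [MvPolynomial.eval_C]
  congr 1
  funext nu
  split_ifs
  · exact (eval_schurSum hN y N nu).symm
  · simp

theorem sum_schurSum_mul_afterSum (hN : 1 ≤ N) (hlam : Antitone lam)
    (hl0 : ∀ i, N ≤ i → lam i = 0) (x : ℝ) :
    ∑ nu ∈ fixedAbove N 0 lam, schurSum N (fun _ => x) N nu * afterSum N (-β) lam (N - 1) nu =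
      MvPolynomial.eval (fun _ => x) (grothendieckG (N := N) β fun i => lam i) := by
  have h1 := sum_afterDet_mul_afterSum (N := N) (u := MvPolynomial.C (-β)) hlam hl0
    (fun i : Fin N => (MvPolynomial.X i : MvPolynomial (Fin N) ℝ)) (s := N - 1) (by omega)
  rw [Nat.sub_self] at h1
  have h2 : afterDet (MvPolynomial.C (-β)) (N - 1)
      (fun i : Fin N => (MvPolynomial.X i : MvPolynomial (Fin N) ℝ)) lam =
      alternantDet fun j => Polynomial.X ^ (lam j + (N - 1 - j.val)) *
        (1 - Polynomial.C β * Polynomial.X) ^ j.val := by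
    unfold afterDet alternantDet
    rw [← Matrix.det_transpose]
    congr 1
    ext1 i j
    simp only [Matrix.transpose_apply, Matrix.of_apply, map_mul, map_pow, map_sub, map_one,
      Polynomial.aeval_X, Polynomial.aeval_C]
    have e1 : min (j : ℕ) (N - 1) = j := by omega
    rw [e1, map_neg, neg_mul, ← sub_eq_add_neg]
    rfl
  have h3 : vandermondeProd MvPolynomial.X * ∑ nu ∈ fixedAbove N 0 lam,
      schurSum N (revVars N) N nu * afterSum N (MvPolynomial.C (-β)) lam (N - 1) nu =
      alternantDet fun j => Polynomial.X ^ (lam j + (N - 1 - j.val)) *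
        (1 - Polynomial.C β * Polynomial.X) ^ j.val := by
    rw [← h2, ← h1, Finset.mul_sum]
    refine Finset.sum_congr rfl fun nu hnu => ?_
    obtain ⟨h4, h5, -⟩ := mem_fixedAbove.1 hnu
    have h6 := vandermondeProd_mul_schurSum N (revVars N) le_rfl h4 h5
    simp only [revVars_apply] at h6
    rw [← mul_assoc, h6]
    congr 1
    unfold alternant afterDet
    congr 1
    ext1 j i
    simp
  rw [grothendieckG, ← eq_alternantQuotient h3, map_sum]
  refine Finset.sum_congr rfl fun nu _ => ?_
  rw [map_mul, eval_schurSum hN]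
  congr 1
  unfold afterSum
  rw [map_chainSum]
  simp only [MvPolynomial.eval_C]
  congr 1
  funext nu
  split_ifs <;> simp

/-- The sum over all chains with the prescribed rows is the product of the two Grothendieck
polynomials. -/
theorem sum_schurSum_mul_diagSum (hN : 1 ≤ N) (hlam : Antitone lam)
    (hl0 : ∀ i, N ≤ i → lam i = 0) (x y : ℝ) :
    ∑ nu ∈ fixedAbove N 0 lam, schurSum N (fun _ => x) N nu *
        diagSum N (-β) lam (schurSum N (fun _ => y) N) (N - 1) nu =
      MvPolynomial.eval (fun _ => x) (grothendieckG (N := N) β fun i => lam i) *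
        MvPolynomial.eval (fun _ => y) (grothendieckGbar (N := N) β fun i => lam i) := by
  rw [← beforeSum_eq_eval hN hlam hl0, ← sum_schurSum_mul_afterSum hN hlam hl0, Finset.sum_mul]
  refine Finset.sum_congr rfl fun nu hnu => ?_
  obtain ⟨h4, h5, h6⟩ := mem_fixedAbove.1 hnu
  rw [diagSum_eq_mul hlam hl0 (by omega) h4 h5 (h6 _ (by omega)), Nat.sub_self]
  have h7 : splice 0 nu lam = lam := by
    funext i
    simp only [splice]
    split_ifs with h
    · exact h6 i h
    · rfl
  have h8 : splice 0 lam nu = nu := by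
    funext i
    simp only [splice]
    split_ifs with h
    · exact (h6 i h).symm
    · rfl
  rw [h7, h8]
  ring

end Polynomials

/-! ### The tableau process -/

section TableauProcess

variable {N : ℕ}

theorem mem_rowWord {m : Fin N → ℕ} {a : ℕ} (h : a ∈ rowWord m) : 0 < a ∧ a ≤ N := by
  simp only [rowWord, List.mem_flatMap, List.mem_replicate] at h
  obtain ⟨j, -, -, rfl⟩ := h
  omega

theorem rowWord_sorted (m : Fin N → ℕ) : (rowWord m).Pairwise (· ≤ ·) := by
  rw [rowWord, List.pairwise_flatMap]
  refine ⟨fun j _ => List.pairwise_replicate.2 (Or.inr le_rfl), ?_⟩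
  refine (List.pairwise_lt_finRange N).imp fun h a ha b hb => ?_
  rw [List.eq_of_mem_replicate ha, List.eq_of_mem_replicate hb]
  exact Nat.succ_le_succ (le_of_lt h)

theorem rowWord_strict {m : Fin N → ℕ} (hm : ∀ j, m j ≤ 1) : (rowWord m).Pairwise (· < ·) := by
  rw [rowWord, List.pairwise_flatMap]
  refine ⟨fun j _ => List.pairwise_replicate.2 (Or.inl (hm j)), ?_⟩
  refine (List.pairwise_lt_finRange N).imp fun h a ha b hb => ?_
  rw [List.eq_of_mem_replicate ha, List.eq_of_mem_replicate hb]
  exact Nat.succ_lt_succ h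

theorem count_rowWord (m : Fin N → ℕ) (j : Fin N) : (rowWord m).count (j.val + 1) = m j := by
  rw [rowWord, List.count_flatMap]
  have h : (List.count (j.val + 1) ∘ fun k : Fin N => List.replicate (m k) (k.val + 1)) =
      fun k => if k = j then m j else 0 := by
    funext k
    simp only [Function.comp, List.count_replicate]
    by_cases hk : k = j
    · simp [hk]
    · have : ¬ (k : ℕ) = j := fun h => hk (Fin.ext h)
      simp [hk, this]
  rw [h, ← List.ofFn_eq_map, List.sum_ofFn]
  simp

/-- The word inserted in step `t + 1`, in the order of insertion. -/
def stepWord (A : Fin N → Fin N → ℕ) (B : Fin (N - 1) → Fin N → ℕ) (t : ℕ) : List ℕ :=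
  if h : t < N then rowWord (A ⟨t, h⟩)
  else if h' : t - N < N - 1 then (rowWord (B ⟨t - N, h'⟩)).reverse else []

theorem tableauAt_succ (A : Fin N → Fin N → ℕ) (B : Fin (N - 1) → Fin N → ℕ) (t : ℕ) :
    tableauAt A B (t + 1) = insertWord (tableauAt A B t) (stepWord A B t) := by
  rw [tableauAt, stepWord]
  split_ifs <;> rfl

theorem mem_stepWord {A : Fin N → Fin N → ℕ} {B : Fin (N - 1) → Fin N → ℕ} {t a : ℕ}
    (h : a ∈ stepWord A B t) : 0 < a ∧ a ≤ N := by
  rw [stepWord] at h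
  split_ifs at h
  · exact mem_rowWord h
  · exact mem_rowWord (List.mem_reverse.1 h)
  · simp at h

theorem insertWord_isGT {T : List (List ℕ)} (hT : RowsSorted N T)
    (hG : ∀ n, IsGT n (countArray T)) {w : List ℕ} (hw : ∀ a ∈ w, 0 < a ∧ a ≤ N) :
    (∀ n, IsGT n (countArray (insertWord T w))) ∧
      ∀ k i, countArray T k i ≤ countArray (insertWord T w) k i := by
  induction w generalizing T with
  | nil => exact ⟨hG, fun _ _ => le_rfl⟩
  | cons a w ih =>
    have hw' := List.forall_mem_cons.1 hw
    have ha : ∀ b ∈ [a], 0 < b ∧ b ≤ N := by simpa using hw'.1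
    have h1 := hT.insertWord ha
    have h2 : ∀ n, RowStep false n (countArray T) (countArray (insertWord T [a])) fun k =>
        [a].count (k + 1) :=
      fun n k _ => cell_insertWord (v := false) hT ha (List.pairwise_singleton _ a) k
    have h3 := fun n => (h2 n).forward (hG n) (countArray_zero h1)
    obtain ⟨h4, h5⟩ := ih h1 (fun n => (h3 n).1) hw'.2
    exact ⟨h4, fun k i => (((h3 k).2 k le_rfl).le i).trans (h5 k i)⟩

theorem tableauAt_valid (A : Fin N → Fin N → ℕ) (B : Fin (N - 1) → Fin N → ℕ) (t : ℕ) :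
    RowsSorted N (tableauAt A B t) ∧ ∀ n, IsGT n (countArray (tableauAt A B t)) := by
  induction t with
  | zero =>
    refine ⟨fun i => by simp [tableauAt], fun n => ⟨?_, fun k _ i => ?_⟩⟩
    · funext i; simp [tableauAt, countArray]
    · simp [tableauAt, countArray]
  | succ t ih =>
    rw [tableauAt_succ]
    exact ⟨ih.1.insertWord fun a => mem_stepWord,
      (insertWord_isGT ih.1 ih.2 fun a => mem_stepWord).1⟩

theorem countArray_tableauAt_mono (A : Fin N → Fin N → ℕ) (B : Fin (N - 1) → Fin N → ℕ) {s t : ℕ}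
    (h : s ≤ t) (k i : ℕ) :
    countArray (tableauAt A B s) k i ≤ countArray (tableauAt A B t) k i := by
  induction t, h using Nat.le_induction with
  | base => exact le_rfl
  | succ t _ ih =>
    rw [tableauAt_succ]
    have h1 := tableauAt_valid A B t
    exact ih.trans ((insertWord_isGT h1.1 h1.2 fun a => mem_stepWord).2 k i)

theorem lambdaOf_eq (A : Fin N → Fin N → ℕ) (B : Fin (N - 1) → Fin N → ℕ) (i : Fin N) :
    lambdaOf A B i = countArray (tableauAt A B (2 * N - 1 - i)) N i := by
  rw [countArray_eq_rowLength (tableauAt_valid A B _).1, lambdaOf]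
  congr 2
  omega

/-- The sequence `lambdaOf A B` is weakly decreasing for arbitrary matrices: all tableaux have
partition shapes, and the shapes grow. -/
theorem antitone_lambdaOf (A : Fin N → Fin N → ℕ) (B : Fin (N - 1) → Fin N → ℕ) :
    Antitone (lambdaOf A B) := by
  intro i j hij
  rw [lambdaOf_eq, lambdaOf_eq]
  have hij' : (i : ℕ) ≤ j := hij
  exact (((tableauAt_valid A B _).2 N).antitone le_rfl hij').trans
    (countArray_tableauAt_mono A B (by omega) N i)

/-- The entry of the matrices that gives the number of letters `k + 1` in step `t + 1`. -/
def stepEntry (A : Fin N → Fin N → ℕ) (B : Fin (N - 1) → Fin N → ℕ) (t : ℕ) (k : Fin N) : ℕ :=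
  if h : t < N then A ⟨t, h⟩ k else if h' : t - N < N - 1 then B ⟨t - N, h'⟩ k else 0

theorem count_stepWord (A : Fin N → Fin N → ℕ) (B : Fin (N - 1) → Fin N → ℕ) (t : ℕ) (k : Fin N) :
    (stepWord A B t).count (k.val + 1) = stepEntry A B t k := by
  rw [stepWord, stepEntry]
  split_ifs <;> simp [count_rowWord]

theorem stepWord_sorted {A : Fin N → Fin N → ℕ} {B : Fin (N - 1) → Fin N → ℕ} {t : ℕ}
    (h : N ≤ t → ∀ k, stepEntry A B t k ≤ 1) : WordSorted (decide (N ≤ t)) (stepWord A B t) := by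
  by_cases ht : t < N
  · simpa [stepWord, ht, not_le.2 ht, WordSorted] using rowWord_sorted _
  · have h1 := h (by omega)
    simp only [stepWord, ht, dif_neg, not_lt.1 ht, decide_true, WordSorted, stepEntry,
      not_false_eq_true] at h1 ⊢
    split_ifs with h2
    · simp only [h2, dif_pos] at h1
      exact List.pairwise_reverse.2 (rowWord_strict h1)
    · exact List.Pairwise.nil

theorem rowStep_tableauAt {A : Fin N → Fin N → ℕ} {B : Fin (N - 1) → Fin N → ℕ} {t : ℕ}
    (h : N ≤ t → ∀ k, stepEntry A B t k ≤ 1) :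
    RowStep (decide (N ≤ t)) N (countArray (tableauAt A B t)) (countArray (tableauAt A B (t + 1)))
      (extendZero (stepEntry A B t)) := by
  intro k hk
  rw [tableauAt_succ]
  have h1 := cell_insertWord (tableauAt_valid A B t).1 (fun a => mem_stepWord) (stepWord_sorted h) k
  have h2 := count_stepWord A B t ⟨k, hk⟩
  simp only at h2
  rw [h2] at h1
  simpa [extendZero, hk] using h1

theorem tableauAt_congr {A A' : Fin N → Fin N → ℕ} {B B' : Fin (N - 1) → Fin N → ℕ} {t : ℕ}
    (h : ∀ s < t, stepEntry A B s = stepEntry A' B' s) : tableauAt A B t = tableauAt A' B' t := by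
  induction t with
  | zero => rfl
  | succ t ih =>
    rw [tableauAt_succ, tableauAt_succ, ih fun s hs => h s (by omega)]
    congr 1
    have h1 := h t (by omega)
    rw [stepWord, stepWord]
    split_ifs with h2 h3
    · congr 1
      funext k
      simpa [stepEntry, h2] using congrFun h1 k
    · congr 2
      funext k
      simpa [stepEntry, h2, h3] using congrFun h1 k
    · rfl

theorem Cell.eq_of_eq {v : Bool} {lam mu nu rho rho' : ℕ → ℕ} {a : ℕ} (h : Cell v lam mu nu rho a)
    (h' : Cell v lam mu nu rho' a) : rho = rho' := by
  obtain ⟨c, hc0, hc⟩ := h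
  obtain ⟨c', hc0', hc'⟩ := h'
  have key : ∀ i, c i = c' i := by
    intro i
    induction i with
    | zero => rw [hc0, hc0']
    | succ i ih =>
      have h1 := hc i
      have h2 := hc' i
      rw [← ih] at h2
      cases v <;> simp only [CellRule] at h1 h2 <;> omega
  funext i
  have h1 := hc i
  have h2 := hc' i
  rw [← key i] at h2
  cases v <;> simp only [CellRule] at h1 h2 <;> omega

theorem RowStep.eq_of_eq {v : Bool} {n : ℕ} {L L' M' : ℕ → ℕ → ℕ} {a : ℕ → ℕ}
    (h : RowStep v n L L' a) (h' : RowStep v n L M' a) (h0 : L' 0 = M' 0) {k : ℕ} (hk : k ≤ n) :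
    L' k = M' k := by
  induction k with
  | zero => exact h0
  | succ k ih =>
    have h1 := h k hk
    rw [ih (by omega)] at h1
    exact h1.eq_of_eq (h' k hk)

theorem RowStep.congr {v : Bool} {n : ℕ} {L M L' M' : ℕ → ℕ → ℕ} {a b : ℕ → ℕ}
    (h : RowStep v n L L' a) (hL : ∀ k ≤ n, L k = M k) (hL' : ∀ k ≤ n, L' k = M' k)
    (ha : ∀ k < n, a k = b k) : RowStep v n M M' b := by
  intro k hk
  rw [← hL k hk.le, ← hL (k + 1) hk, ← hL' k hk.le, ← hL' (k + 1) hk, ← ha k hk]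
  exact h k hk

theorem RowStep.le_one {n : ℕ} {L L' : ℕ → ℕ → ℕ} {a : ℕ → ℕ} (h : RowStep true n L L' a) {k : ℕ}
    (hk : k < n) : a k ≤ 1 := by
  obtain ⟨c, hc0, hc⟩ := h k hk
  rw [← hc0]
  exact (hc 0).1.1

variable (lam : ℕ → ℕ)

/-- The condition on the shape after step `t` that the row which is read off at this step has the
prescribed length. -/
def DiagCond (N : ℕ) (lam : ℕ → ℕ) (t : ℕ) (mu : ℕ → ℕ) : Prop :=
  N ≤ t → mu (2 * N - 1 - t) = lam (2 * N - 1 - t)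

/-- The conditions on the steps up to `t`: the rows that are read off have the prescribed lengths, and
the entries of the second matrix are at most `1`. -/
def History (lam : ℕ → ℕ) (A : Fin N → Fin N → ℕ) (B : Fin (N - 1) → Fin N → ℕ) (t : ℕ) : Prop :=
  (∀ s ≤ t, DiagCond N lam s (countArray (tableauAt A B s) N)) ∧
    ∀ s < t, N ≤ s → ∀ k, stepEntry A B s k ≤ 1

theorem history_congr {A A' : Fin N → Fin N → ℕ} {B B' : Fin (N - 1) → Fin N → ℕ} {t : ℕ}
    (h : ∀ s < t, stepEntry A B s = stepEntry A' B' s) (hh : History lam A B t) :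
    History lam A' B' t := by
  refine ⟨fun s hs => ?_, fun s hs => ?_⟩
  · rw [← tableauAt_congr fun r hr => h r (by omega)]
    exact hh.1 s hs
  · rw [← h s hs]
    exact hh.2 s hs

variable {lam}

/-- The array of the tableau after step `t + 1` determines, together with the shape before this step,
the array before this step and the inserted word. -/
theorem step_iff {A : Fin N → Fin N → ℕ} {B : Fin (N - 1) → Fin N → ℕ} {t : ℕ}
    {L' : ℕ → ℕ → ℕ} (hL' : IsGT N L') {M : (ℕ → ℕ) → ℕ → ℕ → ℕ} {b : (ℕ → ℕ) → ℕ → ℕ}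
    (hM : ∀ nu ∈ below (decide (N ≤ t)) N (L' N), IsGT N (M nu) ∧ M nu N = nu ∧
      RowStep (decide (N ≤ t)) N (M nu) L' (b nu)) :
    ((∀ k ≤ N, countArray (tableauAt A B (t + 1)) k = L' k) ∧ History lam A B (t + 1)) ↔
      DiagCond N lam (t + 1) (L' N) ∧ ∃ nu ∈ below (decide (N ≤ t)) N (L' N),
        ((∀ k ≤ N, countArray (tableauAt A B t) k = M nu k) ∧ History lam A B t) ∧
          ∀ k : Fin N, stepEntry A B t k = b nu k := by
  obtain ⟨hT, hG⟩ := tableauAt_valid A B t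
  constructor
  · rintro ⟨h1, h2⟩
    have h3 := rowStep_tableauAt (h2.2 t (by omega))
    have h4 := h3.congr (fun _ _ => rfl) h1 (fun _ _ => rfl)
    have h5 := h4.forward (hG N) hL'.1
    have h6 : countArray (tableauAt A B t) N ∈ below (decide (N ≤ t)) N (L' N) :=
      mem_below.2 ⟨(hG N).antitone le_rfl, h5.2 N le_rfl, fun i hi => (hG N).eq_zero le_rfl hi⟩
    obtain ⟨h7, h8, h9⟩ := hM _ h6
    have h10 := RowStep.unique hL' (hG N) h7 h4 h9 h8.symm
    refine ⟨by simpa [h1] using h2.1 (t + 1) le_rfl, _, h6, ⟨h10.1, ?_⟩, fun k => ?_⟩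
    · exact ⟨fun s hs => h2.1 s (by omega), fun s hs => h2.2 s (by omega)⟩
    · simpa using h10.2 k k.isLt
  · rintro ⟨h0, nu, hnu, ⟨h1, h2⟩, h3⟩
    obtain ⟨h7, h8, h9⟩ := hM nu hnu
    have h4 : N ≤ t → ∀ k, stepEntry A B t k ≤ 1 := by
      intro ht k
      rw [h3]
      simp only [ht, decide_true] at h9
      exact h9.le_one k.isLt
    have h5 := (rowStep_tableauAt h4).congr (M := M nu) (b := b nu) h1 (fun _ _ => rfl)
      fun k hk => by
        have := h3 ⟨k, hk⟩
        simpa [extendZero, hk] using this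
    have h6 : ∀ k ≤ N, countArray (tableauAt A B (t + 1)) k = L' k := fun k hk =>
      h5.eq_of_eq h9 (by rw [countArray_zero (tableauAt_valid A B _).1, hL'.1]) hk
    refine ⟨h6, fun s hs => ?_, fun s hs => ?_⟩
    · rcases Nat.le_succ_iff.1 hs with hs | rfl
      · exact h2.1 s hs
      · rwa [h6 N le_rfl]
    · rcases Nat.lt_succ_iff_lt_or_eq.1 hs with hs | rfl
      · exact h2.2 s hs
      · exact h4

end TableauProcess

/-! ### The joint law of the shapes -/

section Independence

variable {Ω ι : Type*} {f : ι → Ω → ℕ}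

theorem exists_eq_preimage {S : Finset ι} {E : Set Ω}
    (hE : ∀ ω ω', (∀ i ∈ S, f i ω = f i ω') → ω ∈ E → ω' ∈ E) :
    ∃ s : Set (S → ℕ), E = (fun ω (i : S) => f i ω) ⁻¹' s := by
  refine ⟨(fun ω (i : S) => f i ω) '' E, Set.Subset.antisymm (Set.subset_preimage_image _ _) ?_⟩
  rintro ω' ⟨ω, hω, h⟩
  exact hE ω ω' (fun i hi => congrFun h ⟨i, hi⟩) hω

variable [MeasurableSpace Ω] {P : Measure Ω}

theorem measurableSet_of_dependsOn (hf : ∀ i, Measurable (f i)) {S : Finset ι} {E : Set Ω}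
    (hE : ∀ ω ω', (∀ i ∈ S, f i ω = f i ω') → ω ∈ E → ω' ∈ E) : MeasurableSet E := by
  obtain ⟨s, rfl⟩ := exists_eq_preimage hE
  exact measurable_pi_lambda (fun ω (i : S) => f i ω) (fun i => hf i) MeasurableSet.of_discrete

/-- An event that depends on the variables in `S` only is independent of the values of further
variables, which are independent of each other. -/
theorem real_inter_eq_mul_prod (hf : ∀ i, Measurable (f i)) (h : iIndepFun f P) {S : Finset ι}
    {E : Set Ω} (hE : ∀ ω ω', (∀ i ∈ S, f i ω = f i ω') → ω ∈ E → ω' ∈ E) {n : ℕ}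
    {e : Fin n → ι} (he : Function.Injective e) (heS : ∀ k, e k ∉ S) (a : Fin n → ℕ) :
    P.real (E ∩ {ω | ∀ k, f (e k) ω = a k}) = P.real E * ∏ k, P.real {ω | f (e k) ω = a k} := by
  classical
  obtain ⟨s, rfl⟩ := exists_eq_preimage hE
  set T : Finset ι := Finset.univ.image e with hT
  have hdisj : Disjoint S T := by
    rw [Finset.disjoint_right]
    intro i hi
    obtain ⟨k, -, rfl⟩ := Finset.mem_image.1 hi
    exact heS k
  have hmem : ∀ k, e k ∈ T := fun k => Finset.mem_image_of_mem _ (Finset.mem_univ k)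
  have h1 := (h.indepFun_finset S T hdisj hf).measure_inter_preimage_eq_mul s
    {g | ∀ k, g ⟨e k, hmem k⟩ = a k} MeasurableSet.of_discrete MeasurableSet.of_discrete
  have h2 := (h.precomp he).measure_inter_preimage_eq_mul Finset.univ
    (sets := fun k => {a k}) fun _ _ => MeasurableSet.of_discrete
  have h3 : (⋂ k ∈ Finset.univ, (fun ω => f (e k) ω) ⁻¹' {a k}) = {ω | ∀ k, f (e k) ω = a k} := by
    ext ω
    simp
  have h4 : ((fun ω (i : T) => f i ω) ⁻¹' {g | ∀ k, g ⟨e k, hmem k⟩ = a k}) =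
      {ω | ∀ k, f (e k) ω = a k} := rfl
  rw [h4, ← h3, h2, h3] at h1
  simp only [measureReal_def]
  rw [h1, ENNReal.toReal_mul, ENNReal.toReal_prod]
  rfl

end Independence

section Law

variable {Ω : Type*} {N : ℕ}

/-- The array of the random tableau after step `t`. -/
def arrayAt (A : Fin N → Fin N → Ω → ℕ) (B : Fin (N - 1) → Fin N → Ω → ℕ) (t : ℕ) (ω : Ω) :
    ℕ → ℕ → ℕ :=
  countArray (tableauAt (fun i j => A i j ω) (fun i j => B i j ω) t)

/-- The random numbers of letters that are inserted in step `t + 1`. -/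
def entryAt (A : Fin N → Fin N → Ω → ℕ) (B : Fin (N - 1) → Fin N → Ω → ℕ) (t : ℕ) (ω : Ω) :
    Fin N → ℕ :=
  stepEntry (fun i j => A i j ω) (fun i j => B i j ω) t

/-- The event that `History` holds up to step `t` and that the levels `k, …, N` of the array after
step `t` are given by `L`. -/
def stateEvent (A : Fin N → Fin N → Ω → ℕ) (B : Fin (N - 1) → Fin N → Ω → ℕ) (lam : ℕ → ℕ)
    (t k : ℕ) (L : ℕ → ℕ → ℕ) : Set Ω :=
  {ω | (∀ j, k ≤ j → j ≤ N → arrayAt A B t ω j = L j) ∧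
    History lam (fun i j => A i j ω) (fun i j => B i j ω) t}

variable {A : Fin N → Fin N → Ω → ℕ} {B : Fin (N - 1) → Fin N → Ω → ℕ} {lam : ℕ → ℕ}

theorem stateEvent_dependsOn {t k : ℕ} {L : ℕ → ℕ → ℕ} {ω ω' : Ω}
    (h : ∀ s < t, entryAt A B s ω = entryAt A B s ω') (hω : ω ∈ stateEvent A B lam t k L) :
    ω' ∈ stateEvent A B lam t k L := by
  refine ⟨fun j hj hj' => ?_, history_congr lam h hω.2⟩
  rw [← hω.1 j hj hj', arrayAt, arrayAt, tableauAt_congr h]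

/-- The index of the entry `k` of the matrix row that is inserted in step `t + 1`. -/
def entryIndex {t : ℕ} (ht : t < 2 * N - 1) (k : Fin N) :
    (Fin N × Fin N) ⊕ (Fin (N - 1) × Fin N) :=
  if h : t < N then Sum.inl (⟨t, h⟩, k) else Sum.inr (⟨t - N, by omega⟩, k)

/-- The step before which an entry is inserted. -/
def entryTime : (Fin N × Fin N) ⊕ (Fin (N - 1) × Fin N) → ℕ :=
  Sum.elim (fun p => p.1) fun p => N + p.1

theorem entryTime_entryIndex {t : ℕ} (ht : t < 2 * N - 1) (k : Fin N) :
    entryTime (entryIndex ht k) = t := by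
  unfold entryIndex entryTime
  split_ifs
  · rfl
  · simp only [Sum.elim_inr]; omega

theorem entryIndex_injective {t : ℕ} (ht : t < 2 * N - 1) :
    Function.Injective (entryIndex (N := N) ht) := by
  intro k l h
  unfold entryIndex at h
  split_ifs at h
  · simpa using h
  · simpa using h

theorem entryAt_eq {t : ℕ} (ht : t < 2 * N - 1) (k : Fin N) (ω : Ω) :
    entryAt A B t ω k = Sum.elim (fun p : Fin N × Fin N => A p.1 p.2)
      (fun p : Fin (N - 1) × Fin N => B p.1 p.2) (entryIndex ht k) ω := by
  unfold entryAt stepEntry entryIndex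
  have : t - N < N - 1 ∨ t < N := by omega
  split_ifs
  · rfl
  · rfl
  · omega

theorem entryAt_congr {t : ℕ} {ω ω' : Ω}
    (h : ∀ i ∈ Finset.univ.filter (fun i => entryTime i < t),
      Sum.elim (fun p : Fin N × Fin N => A p.1 p.2) (fun p : Fin (N - 1) × Fin N => B p.1 p.2) i ω =
      Sum.elim (fun p : Fin N × Fin N => A p.1 p.2)
        (fun p : Fin (N - 1) × Fin N => B p.1 p.2) i ω') :
    ∀ s < t, entryAt A B s ω = entryAt A B s ω' := by
  intro s hs
  funext k
  by_cases h1 : s < 2 * N - 1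
  · rw [entryAt_eq h1, entryAt_eq h1]
    refine h _ ?_
    rw [Finset.mem_filter, entryTime_entryIndex]
    exact ⟨Finset.mem_univ _, hs⟩
  · have h2 : ¬ s < N := by have := k.isLt; omega
    have h3 : ¬ s - N < N - 1 := by omega
    simp [entryAt, stepEntry, h2, h3]

variable [MeasurableSpace Ω] {P : Measure Ω}

/-- The weight of a box that is added in step `t + 1`. -/
noncomputable def stepWeight (N : ℕ) (y β : ℝ) (t : ℕ) : ℝ := if t < N then y else -β

/-- The normalization of the law of an entry that is used in step `t + 1`. -/
noncomputable def stepNorm (N : ℕ) (x y β : ℝ) (t : ℕ) : ℝ :=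
  if t < N then 1 - x * y else (1 - β * x)⁻¹

open Classical in
/-- The weighted sum over the chains of shapes that satisfy the conditions on the rows. -/
noncomputable def shapeSum (N : ℕ) (y β : ℝ) (lam : ℕ → ℕ) : ℕ → (ℕ → ℕ) → ℝ :=
  chainSum N (fun t => decide (N ≤ t)) (stepWeight N y β) (DiagCond N lam)
    fun mu => if mu = 0 then 1 else 0

theorem shapeSum_succ_of_cond {y β : ℝ} {t : ℕ} {mu : ℕ → ℕ} (h : DiagCond N lam (t + 1) mu) :
    shapeSum N y β lam (t + 1) mu = ∑ nu ∈ below (decide (N ≤ t)) N mu,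
      stepWeight N y β t ^ (size N mu - size N nu) * shapeSum N y β lam t nu :=
  if_pos h

theorem shapeSum_succ_of_not {y β : ℝ} {t : ℕ} {mu : ℕ → ℕ} (h : ¬ DiagCond N lam (t + 1) mu) :
    shapeSum N y β lam (t + 1) mu = 0 :=
  if_neg h

theorem stateEvent_measurableSet (hAm : ∀ i j, Measurable (A i j))
    (hBm : ∀ i j, Measurable (B i j)) (t k : ℕ) (L : ℕ → ℕ → ℕ) :
    MeasurableSet (stateEvent A B lam t k L) :=
  measurableSet_of_dependsOn (f := Sum.elim (fun p : Fin N × Fin N => A p.1 p.2)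
      (fun p : Fin (N - 1) × Fin N => B p.1 p.2))
    (by rintro (p | p); exacts [hAm _ _, hBm _ _])
    fun _ _ h hω => stateEvent_dependsOn (entryAt_congr h) hω

theorem entryAt_measurableSet (hAm : ∀ i j, Measurable (A i j))
    (hBm : ∀ i j, Measurable (B i j)) (t : ℕ) (a : Fin N → ℕ) :
    MeasurableSet {ω | ∀ k, entryAt A B t ω k = a k} :=
  measurableSet_of_dependsOn (f := Sum.elim (fun p : Fin N × Fin N => A p.1 p.2)
      (fun p : Fin (N - 1) × Fin N => B p.1 p.2))
    (by rintro (p | p); exacts [hAm _ _, hBm _ _])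
    fun ω ω' h hω => by
      have h1 := entryAt_congr (t := t + 1) h t (by omega)
      show ∀ k, entryAt A B t ω' k = a k
      rw [← h1]
      exact hω

variable {x y β : ℝ}

theorem prod_real_entryAt (hx : 0 ≤ x) (hβ : β ≤ 0)
    (hA : ∀ i j, ∀ k : ℕ, P.real {ω | A i j ω = k} = (1 - x * y) * (x * y) ^ k)
    (hB1 : ∀ i j, P.real {ω | B i j ω = 1} = -β * x / (1 - β * x))
    (hB0 : ∀ i j, P.real {ω | B i j ω = 0} = 1 - -β * x / (1 - β * x))
    {t : ℕ} (ht : t < 2 * N - 1) {a : Fin N → ℕ} (ha : N ≤ t → ∀ k, a k ≤ 1) :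
    ∏ k, P.real {ω | entryAt A B t ω k = a k} =
      stepNorm N x y β t ^ N * (x * stepWeight N y β t) ^ ∑ k, a k := by
  have h : ∀ k, P.real {ω | entryAt A B t ω k = a k} =
      stepNorm N x y β t * (x * stepWeight N y β t) ^ a k := by
    intro k
    by_cases h1 : t < N
    · simp only [entryAt, stepEntry, h1, dif_pos, hA, stepNorm, stepWeight, if_pos]
    · have h2 : t - N < N - 1 := by omega
      have h3 : 1 - β * x ≠ 0 := by nlinarith [mul_nonneg (neg_nonneg.2 hβ) hx]
      simp only [entryAt, stepEntry, h1, h2, dif_pos, dif_neg, stepNorm, stepWeight, if_neg,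
        not_false_eq_true]
      rcases Nat.le_one_iff_eq_zero_or_eq_one.1 (ha (by omega) k) with h4 | h4
      · rw [h4, hB0]
        field_simp
        ring
      · rw [h4, hB1]
        field_simp
  rw [Finset.prod_congr rfl fun k _ => h k, Finset.prod_mul_distrib, Finset.prod_pow_eq_pow_sum]
  simp

variable [IsProbabilityMeasure P]

/-- The law of the array after step `t`, together with the conditions on the rows: given its shape,
the array has the weight of a semistandard tableau, and the shapes form a Schur process. -/
theorem real_stateEvent_zero (hx : 0 ≤ x) (hβ : β ≤ 0) (hN : 1 ≤ N)
    (hAm : ∀ i j, Measurable (A i j)) (hBm : ∀ i j, Measurable (B i j))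
    (hindep : iIndepFun (Sum.elim (fun p : Fin N × Fin N => A p.1 p.2)
      (fun p : Fin (N - 1) × Fin N => B p.1 p.2)) P)
    (hA : ∀ i j, ∀ k : ℕ, P.real {ω | A i j ω = k} = (1 - x * y) * (x * y) ^ k)
    (hB1 : ∀ i j, P.real {ω | B i j ω = 1} = -β * x / (1 - β * x))
    (hB0 : ∀ i j, P.real {ω | B i j ω = 0} = 1 - -β * x / (1 - β * x))
    {t : ℕ} (ht : t ≤ 2 * N - 1) {L : ℕ → ℕ → ℕ} (hL : IsGT N L) :
    P.real (stateEvent A B lam t 0 L) = (∏ s ∈ Finset.range t, stepNorm N x y β s ^ N) *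
      (x ^ size N (L N) * shapeSum N y β lam t (L N)) := by
  induction t generalizing L with
  | zero =>
    have h0 : ∀ j, (∀ ω, arrayAt A B 0 ω j = 0) := by
      intro j ω
      funext i
      simp [arrayAt, tableauAt, countArray]
    by_cases h : L N = 0
    · have h1 : ∀ d k, k + d = N → L k = 0 := by
        intro d
        induction d with
        | zero => rintro k rfl; exact h
        | succ d ih =>
          intro k hk
          funext i
          have h2 := (hL.2 k (by omega) i).2
          rw [ih (k + 1) (by omega)] at h2
          exact Nat.le_zero.1 h2
      have h2 : stateEvent A B lam 0 0 L = Set.univ := by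
        refine Set.eq_univ_of_forall fun ω => ⟨fun j _ hj => ?_, fun s hs h3 => ?_, ?_⟩
        · rw [h0, h1 (N - j) j (by omega)]
        · omega
        · intro s hs; omega
      simp [h2, h, shapeSum, chainSum, size]
    · have h2 : stateEvent A B lam 0 0 L = ∅ := by
        refine Set.eq_empty_of_forall_notMem fun ω hω => h ?_
        rw [← hω.1 N (by omega) le_rfl, h0]
      simp [h2, h, shapeSum, chainSum]
  | succ t ih =>
    have ex : ∀ nu, ∃ M b, nu ∈ below (decide (N ≤ t)) N (L N) → IsGT N M ∧ M N = nu ∧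
        RowStep (decide (N ≤ t)) N M L b := by
      intro nu
      by_cases h : nu ∈ below (decide (N ≤ t)) N (L N)
      · obtain ⟨M, b, h1⟩ := RowStep.exists hL (mem_below.1 h).1 (mem_below.1 h).2.1
        exact ⟨M, b, fun _ => h1⟩
      · exact ⟨0, 0, fun h' => absurd h' h⟩
    choose M b hM using ex
    have hiff := fun ω => step_iff (A := fun i j => A i j ω) (B := fun i j => B i j ω)
      (lam := lam) (t := t) hL hM
    by_cases hc : DiagCond N lam (t + 1) (L N)
    · have h1 : stateEvent A B lam (t + 1) 0 L = ⋃ nu ∈ below (decide (N ≤ t)) N (L N),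
          (stateEvent A B lam t 0 (M nu) ∩ {ω | ∀ k, entryAt A B t ω k = b nu k}) := by
        ext ω
        simp only [Set.mem_iUnion, exists_prop]
        constructor
        · intro hω
          obtain ⟨-, nu, hnu, h2, h3⟩ := (hiff ω).1 ⟨fun k hk => hω.1 k (Nat.zero_le k) hk, hω.2⟩
          exact ⟨nu, hnu, ⟨fun k _ hk => h2.1 k hk, h2.2⟩, h3⟩
        · rintro ⟨nu, hnu, h2, h3⟩
          have h4 := (hiff ω).2 ⟨hc, nu, hnu, ⟨fun k hk => h2.1 k (Nat.zero_le k) hk, h2.2⟩, h3⟩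
          exact ⟨fun k _ hk => h4.1 k hk, h4.2⟩
      rw [h1, measureReal_biUnion_finset]
      · rw [shapeSum_succ_of_cond hc, Finset.mul_sum, Finset.mul_sum]
        refine Finset.sum_congr rfl fun nu hnu => ?_
        obtain ⟨h2, h3, h4⟩ := hM nu hnu
        have h5 : P.real (stateEvent A B lam t 0 (M nu) ∩ {ω | ∀ k, entryAt A B t ω k = b nu k}) =
            P.real (stateEvent A B lam t 0 (M nu)) *
              ∏ k : Fin N, P.real {ω | entryAt A B t ω k = b nu k} := by
          simp only [entryAt_eq (A := A) (B := B) (show t < 2 * N - 1 by omega)]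
          refine real_inter_eq_mul_prod (by rintro (p | p); exacts [hAm _ _, hBm _ _]) hindep
            (S := Finset.univ.filter fun i => entryTime i < t)
            (fun ω ω' h hω => stateEvent_dependsOn (entryAt_congr h) hω)
            (entryIndex_injective _) (fun k => ?_) fun k => b nu k
          simp [entryTime_entryIndex]
        have h6 : N ≤ t → ∀ k : Fin N, b nu k ≤ 1 := by
          intro ht k
          simp only [ht, decide_true] at h4
          exact h4.le_one k.isLt
        have h7 := h4.size_add h2 hL.1
        rw [h3, Finset.sum_range] at h7
        have h8 : ∑ k : Fin N, b nu k = size N (L N) - size N nu := by omega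
        rw [h5, prod_real_entryAt hx hβ hA hB1 hB0 (by omega) h6, ih (by omega) h2, h3,
          Finset.prod_range_succ, h8, ← h7, Nat.add_sub_cancel_left, mul_pow, pow_add]
        ring
      · intro nu hnu nu' hnu' hne
        refine Set.disjoint_left.2 fun ω h2 h3 => hne ?_
        rw [← (hM nu hnu).2.1, ← (hM nu' hnu').2.1, ← h2.1.1 N (by omega) le_rfl,
          ← h3.1.1 N (by omega) le_rfl]
      · exact fun nu _ => (stateEvent_measurableSet hAm hBm _ _ _).inter
          (entryAt_measurableSet hAm hBm _ _)
    · have h1 : stateEvent A B lam (t + 1) 0 L = ∅ := by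
        refine Set.eq_empty_of_forall_notMem fun ω hω => hc ?_
        exact ((hiff ω).1 ⟨fun k hk => hω.1 k (Nat.zero_le k) hk, hω.2⟩).1
      rw [h1, shapeSum_succ_of_not hc]
      simp

/-- Summation over the lower levels of the array produces a Schur polynomial. -/
theorem real_stateEvent (hx : 0 ≤ x) (hβ : β ≤ 0) (hN : 1 ≤ N)
    (hAm : ∀ i j, Measurable (A i j)) (hBm : ∀ i j, Measurable (B i j))
    (hindep : iIndepFun (Sum.elim (fun p : Fin N × Fin N => A p.1 p.2)
      (fun p : Fin (N - 1) × Fin N => B p.1 p.2)) P)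
    (hA : ∀ i j, ∀ k : ℕ, P.real {ω | A i j ω = k} = (1 - x * y) * (x * y) ^ k)
    (hB1 : ∀ i j, P.real {ω | B i j ω = 1} = -β * x / (1 - β * x))
    (hB0 : ∀ i j, P.real {ω | B i j ω = 0} = 1 - -β * x / (1 - β * x))
    {t : ℕ} (ht : t ≤ 2 * N - 1) {k : ℕ} (hk : k ≤ N) {L : ℕ → ℕ → ℕ}
    (hL : ∀ j, k ≤ j → j < N → Interlace (L j) (L (j + 1))) (hk0 : Antitone (L k)) :
    P.real (stateEvent A B lam t k L) = (∏ s ∈ Finset.range t, stepNorm N x y β s ^ N) *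
      (x ^ (size N (L N) - size N (L k)) * schurSum N (fun _ => x) k (L k) *
        shapeSum N y β lam t (L N)) := by
  induction k generalizing L with
  | zero =>
    by_cases h : L 0 = 0
    · rw [real_stateEvent_zero hx hβ hN hAm hBm hindep hA hB1 hB0 ht
        ⟨h, fun j hj => hL j (Nat.zero_le j) hj⟩]
      simp [h, schurSum, chainSum, size]
    · have h1 : stateEvent A B lam t 0 L = ∅ := by
        refine Set.eq_empty_of_forall_notMem fun ω hω => h ?_
        rw [← hω.1 0 le_rfl (Nat.zero_le N)]
        exact countArray_zero (tableauAt_valid _ _ t).1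
      simp [h1, h, schurSum, chainSum]
  | succ k ih =>
    have h1 : stateEvent A B lam t (k + 1) L = ⋃ nu ∈ below false N (L (k + 1)),
        stateEvent A B lam t k (Function.update L k nu) := by
      ext ω
      have hG := (tableauAt_valid (fun i j => A i j ω) (fun i j => B i j ω) t).2 N
      simp only [Set.mem_iUnion, exists_prop]
      constructor
      · intro hω
        have h2 : arrayAt A B t ω k ∈ below false N (L (k + 1)) := by
          rw [← hω.1 (k + 1) le_rfl hk]
          exact mem_below.2 ⟨hG.antitone (by omega), hG.2 k hk,
            fun i hi => hG.eq_zero (k := k) (by omega) (by omega)⟩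
        refine ⟨_, h2, fun j hj hj' => ?_, hω.2⟩
        rcases Nat.eq_or_lt_of_le hj with rfl | hj
        · simp
        · rw [Function.update_of_ne (by omega)]
          exact hω.1 j hj hj'
      · rintro ⟨nu, -, hω⟩
        refine ⟨fun j hj hj' => ?_, hω.2⟩
        rw [hω.1 j (by omega) hj', Function.update_of_ne (by omega)]
    have hmono : ∀ j, k + 1 ≤ j → j ≤ N → size N (L (k + 1)) ≤ size N (L j) := by
      intro j hj
      induction j, hj using Nat.le_induction with
      | base => exact fun _ => le_rfl
      | succ j hj ih' =>
        exact fun hj' => (ih' (by omega)).trans (size_mono fun i => (hL j hj hj' i).2)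
    rw [h1, measureReal_biUnion_finset]
    · rw [schurSum_succ, Finset.mul_sum, Finset.sum_mul, Finset.mul_sum]
      refine Finset.sum_congr rfl fun nu hnu => ?_
      obtain ⟨h2, h3, -⟩ := mem_below.1 hnu
      have h4 : size N nu ≤ size N (L (k + 1)) := size_mono fun i => h3.le i
      have h5 := hmono N hk le_rfl
      have h6 : Function.update L k nu N = L N := Function.update_of_ne (by omega) _ _
      rw [ih (by omega) (fun j hj hj' => ?_) (by simpa using h2), h6, Function.update_self]
      · have h7 : size N (L N) - size N nu = (size N (L N) - size N (L (k + 1))) +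
            (size N (L (k + 1)) - size N nu) := by omega
        rw [h7, pow_add]
        ring
      · rcases Nat.eq_or_lt_of_le hj with rfl | hj
        · simpa [Strip] using h3
        · rw [Function.update_of_ne (by omega), Function.update_of_ne (by omega)]
          exact hL j hj hj'
    · intro nu _ nu' _ hne
      refine Set.disjoint_left.2 fun ω h2 h3 => hne ?_
      have h4 := h2.1 k le_rfl (by omega)
      have h5 := h3.1 k le_rfl (by omega)
      simpa using h4.symm.trans h5
    · exact fun nu _ => stateEvent_measurableSet hAm hBm _ _ _

theorem shapeSum_of_lt {t : ℕ} (ht : t < N) (mu : ℕ → ℕ) :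
    shapeSum N y β lam t mu = schurSum N (fun _ => y) t mu := by
  induction t generalizing mu with
  | zero => rfl
  | succ t ih =>
    rw [shapeSum_succ_of_cond (fun h => by omega), schurSum_succ]
    have h1 : decide (N ≤ t) = false := by simp; omega
    rw [h1]
    refine Finset.sum_congr rfl fun nu _ => ?_
    rw [ih (by omega), stepWeight, if_pos (by omega)]

theorem shapeSum_add (hN : 1 ≤ N) (s : ℕ) (mu : ℕ → ℕ) :
    shapeSum N y β lam (N + s) mu = diagSum N (-β) lam (schurSum N (fun _ => y) N) s mu := by
  have hcond : ∀ s mu, DiagCond N lam (N + s) mu ↔ mu (N - 1 - s) = lam (N - 1 - s) := by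
    intro s mu
    have h1 : 2 * N - 1 - (N + s) = N - 1 - s := by omega
    rw [DiagCond, h1]
    exact ⟨fun h => h (by omega), fun h _ => h⟩
  induction s generalizing mu with
  | zero =>
    by_cases h : mu (N - 1) = lam (N - 1)
    · have h1 : diagSum N (-β) lam (schurSum N (fun _ => y) N) 0 mu = schurSum N (fun _ => y) N mu :=
        if_pos h
      have h2 := (hcond 0 mu).2 h
      obtain ⟨n, rfl⟩ : ∃ n, N = n + 1 := ⟨N - 1, by omega⟩
      rw [h1, Nat.add_zero, shapeSum_succ_of_cond h2, schurSum_succ]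
      have h3 : decide (n + 1 ≤ n) = false := by simp
      rw [h3]
      refine Finset.sum_congr rfl fun nu _ => ?_
      rw [shapeSum_of_lt (by omega), stepWeight, if_pos (by omega)]
    · rw [diagSum_eq_zero (by simpa using h)]
      have h2 := fun h' => h ((hcond 0 mu).1 h')
      obtain ⟨n, rfl⟩ : ∃ n, N = n + 1 := ⟨N - 1, by omega⟩
      exact shapeSum_succ_of_not h2
  | succ s ih =>
    by_cases h : mu (N - 1 - (s + 1)) = lam (N - 1 - (s + 1))
    · rw [← Nat.add_assoc, shapeSum_succ_of_cond (t := N + s) ((hcond (s + 1) mu).2 h), diagSum_succ h]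
      have h3 : decide (N ≤ N + s) = true := by simp
      rw [h3]
      refine Finset.sum_congr rfl fun nu _ => ?_
      rw [ih, stepWeight, if_neg (by omega)]
    · rw [diagSum_eq_zero h, ← Nat.add_assoc]
      exact shapeSum_succ_of_not fun h' => h ((hcond (s + 1) mu).1 h')

theorem prod_stepNorm (hN : 1 ≤ N) :
    ∏ s ∈ Finset.range (2 * N - 1), stepNorm N x y β s ^ N =
      1 / ((∏ _i : Fin N, (1 - x * β) ^ (N - 1)) * ∏ _i : Fin N, ∏ _j : Fin N, (1 - x * y)⁻¹) := by
  have h1 : 2 * N - 1 = N + (N - 1) := by omega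
  rw [h1, Finset.prod_range_add]
  have h2 : ∀ s ∈ Finset.range N, stepNorm N x y β s ^ N = (1 - x * y) ^ N := fun s hs => by
    rw [stepNorm, if_pos (Finset.mem_range.1 hs)]
  have h3 : ∀ s ∈ Finset.range (N - 1), stepNorm N x y β (N + s) ^ N = ((1 - β * x)⁻¹) ^ N :=
    fun s hs => by rw [stepNorm, if_neg (by omega)]
  rw [Finset.prod_congr rfl h2, Finset.prod_congr rfl h3]
  simp only [Finset.prod_const, Finset.card_range, Finset.card_univ, Fintype.card_fin, inv_pow,
    one_div, mul_inv, inv_inv, ← pow_mul]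
  rw [mul_comm x β, mul_comm N (N - 1)]
  ring

/-- The entries of the second matrix are almost surely at most `1`. -/
theorem ae_le_one (hBm : ∀ i j, Measurable (B i j))
    (hB1 : ∀ i j, P.real {ω | B i j ω = 1} = -β * x / (1 - β * x))
    (hB0 : ∀ i j, P.real {ω | B i j ω = 0} = 1 - -β * x / (1 - β * x)) :
    ∀ᵐ ω ∂P, ∀ i j, B i j ω ≤ 1 := by
  rw [ae_all_iff]
  intro i
  rw [ae_all_iff]
  intro j
  have h1 : P.real ({ω | B i j ω = 0} ∪ {ω | B i j ω = 1}) = 1 := by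
    rw [measureReal_union (s₂ := {ω | B i j ω = 1}) ?_ (hBm i j (measurableSet_singleton 1)), hB0, hB1]
    · ring
    · refine Set.disjoint_left.2 fun ω h2 h3 => ?_
      simp only [Set.mem_ofPred_eq] at h2 h3
      omega
  have h2 : MeasurableSet ({ω | B i j ω = 0} ∪ {ω | B i j ω = 1}) :=
    (hBm i j (measurableSet_singleton 0)).union (hBm i j (measurableSet_singleton 1))
  have h3 : P ({ω | B i j ω = 0} ∪ {ω | B i j ω = 1})ᶜ = 0 := by
    rw [prob_compl_eq_zero_iff h2]
    rw [measureReal_def] at h1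
    exact (ENNReal.toReal_eq_one_iff _).1 h1
  filter_upwards [compl_mem_ae_iff.2 h3] with ω hω
  simp only [compl_compl, Set.mem_union, Set.mem_ofPred_eq] at hω
  omega

/-- The law of the row lengths that are read off from the process. -/
theorem real_lambdaOf_eq (hN : 1 ≤ N) (hx : 0 ≤ x) (hβ : β ≤ 0)
    (hAm : ∀ i j, Measurable (A i j)) (hBm : ∀ i j, Measurable (B i j))
    (hindep : iIndepFun (Sum.elim (fun p : Fin N × Fin N => A p.1 p.2)
      (fun p : Fin (N - 1) × Fin N => B p.1 p.2)) P)
    (hA : ∀ i j, ∀ k : ℕ, P.real {ω | A i j ω = k} = (1 - x * y) * (x * y) ^ k)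
    (hB1 : ∀ i j, P.real {ω | B i j ω = 1} = -β * x / (1 - β * x))
    (hB0 : ∀ i j, P.real {ω | B i j ω = 0} = 1 - -β * x / (1 - β * x))
    {lam : Fin N → ℕ} (hlam : Antitone lam) :
    P.real {ω | lambdaOf (fun i j => A i j ω) (fun i j => B i j ω) = lam} =
      grothendieckWeight β (fun _ => x) (fun _ => y) lam := by
  have hanti : Antitone (extendZero lam) := by
    refine antitone_nat_of_succ_le fun i => ?_
    by_cases hi : i + 1 < N
    · have h1 : i < N := by omega
      simp only [extendZero, hi, h1, dif_pos]
      exact hlam (Fin.mk_le_mk.2 (Nat.le_add_right i 1))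
    · rw [extendZero_of_le lam (by omega)]
      exact Nat.zero_le _
  have hl0 : ∀ i, N ≤ i → extendZero lam i = 0 := fun i hi => extendZero_of_le lam hi
  have h1 : {ω | lambdaOf (fun i j => A i j ω) (fun i j => B i j ω) = lam} =ᵐ[P]
      ⋃ mu ∈ fixedAbove N 0 (extendZero lam),
        stateEvent A B (extendZero lam) (2 * N - 1) N fun _ => mu := by
    filter_upwards [ae_le_one hBm hB1 hB0] with ω hω
    rw [eq_iff_iff]
    have hG := fun t => (tableauAt_valid (fun i j => A i j ω) (fun i j => B i j ω) t).2 N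
    show lambdaOf (fun i j => A i j ω) (fun i j => B i j ω) = lam ↔ ω ∈ (⋃ mu ∈ _, _)
    simp only [Set.mem_iUnion, exists_prop]
    constructor
    · intro h
      have hdiag : ∀ s ≤ 2 * N - 1, DiagCond N (extendZero lam) s
          (countArray (tableauAt (fun i j => A i j ω) (fun i j => B i j ω) s) N) := by
        intro s hs hNs
        have h3 : 2 * N - 1 - s < N := by omega
        have h4 := congrFun h ⟨2 * N - 1 - s, h3⟩
        have h5 : 2 * N - 1 - (2 * N - 1 - s) = s := by omega
        rw [lambdaOf_eq] at h4
        simp only [h5] at h4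
        simpa [extendZero, h3] using h4
      refine ⟨arrayAt A B (2 * N - 1) ω N, mem_fixedAbove.2 ⟨(hG _).antitone le_rfl,
        fun i hi => (hG _).eq_zero le_rfl hi, fun i hi => ?_⟩, fun j hj hj' => ?_, hdiag,
        fun s hs hNs k => ?_⟩
      · obtain rfl : i = 0 := by omega
        have := hdiag (2 * N - 1) le_rfl (by omega)
        rwa [Nat.sub_self] at this
      · rw [le_antisymm hj' hj]
      · have h3 : s - N < N - 1 := by omega
        simpa [stepEntry, not_lt.2 hNs, h3] using hω _ _
    · rintro ⟨mu, -, -, h2, -⟩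
      funext i
      have hi := i.isLt
      have h3 := h2 (2 * N - 1 - i) (by omega) (by omega)
      have h4 : 2 * N - 1 - (2 * N - 1 - (i : ℕ)) = i := by omega
      rw [h4] at h3
      rw [lambdaOf_eq, h3, extendZero_fin]
  have h2 : ∀ mu ∈ fixedAbove N 0 (extendZero lam),
      P.real (stateEvent A B (extendZero lam) (2 * N - 1) N fun _ => mu) =
        (∏ s ∈ Finset.range (2 * N - 1), stepNorm N x y β s ^ N) *
          (schurSum N (fun _ => x) N mu *
            diagSum N (-β) (extendZero lam) (schurSum N (fun _ => y) N) (N - 1) mu) := by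
    intro mu hmu
    rw [real_stateEvent hx hβ hN hAm hBm hindep hA hB1 hB0 le_rfl le_rfl
      (fun j hj hj' => by omega) (mem_fixedAbove.1 hmu).1, ← shapeSum_add hN]
    have h3 : N + (N - 1) = 2 * N - 1 := by omega
    rw [h3, Nat.sub_self, pow_zero, one_mul]
  have h3 : (fun i : Fin N => extendZero lam i) = lam := funext fun i => extendZero_fin lam i
  rw [measureReal_congr h1, measureReal_biUnion_finset, Finset.sum_congr rfl h2, ← Finset.mul_sum,
    sum_schurSum_mul_diagSum hN hanti hl0, prod_stepNorm hN, h3,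
    grothendieckWeight, mul_assoc]
  · intro mu _ mu' _ hne
    refine Set.disjoint_left.2 fun ω h4 h5 => hne ?_
    exact (h4.1 N le_rfl le_rfl).symm.trans (h5.1 N le_rfl le_rfl)
  · exact fun mu _ => stateEvent_measurableSet hAm hBm _ _ _

end Law

end GrothendieckRSK

theorem proposition5p8 {Ω : Type*} [MeasurableSpace Ω] (P : Measure Ω) [IsProbabilityMeasure P]
    (N : ℕ) (hN : 1 ≤ N) (x y β : ℝ) (hx : 0 ≤ x) (hy : 0 ≤ y) (hxy : x * y < 1) (hβ : β ≤ 0)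
    (A : Fin N → Fin N → Ω → ℕ) (B : Fin (N - 1) → Fin N → Ω → ℕ)
    (hAm : ∀ i j, Measurable (A i j)) (hBm : ∀ i j, Measurable (B i j))
    (hindep : iIndepFun (Sum.elim (fun p : Fin N × Fin N => A p.1 p.2)
      (fun p : Fin (N - 1) × Fin N => B p.1 p.2)) P)
    (hA : ∀ i j, ∀ k : ℕ, P.real {ω | A i j ω = k} = (1 - x * y) * (x * y) ^ k)
    (hB1 : ∀ i j, P.real {ω | B i j ω = 1} = -β * x / (1 - β * x))
    (hB0 : ∀ i j, P.real {ω | B i j ω = 0} = 1 - -β * x / (1 - β * x)) :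
    (∀ ω, Antitone (GrothendieckRSK.lambdaOf (fun i j => A i j ω) (fun i j => B i j ω))) ∧
    ∀ lam : Fin N → ℕ, Antitone lam →
      P.real {ω | GrothendieckRSK.lambdaOf (fun i j => A i j ω) (fun i j => B i j ω) = lam} =
        GrothendieckRSK.grothendieckWeight β (fun _ => x) (fun _ => y) lam := by
  exact ⟨fun ω => GrothendieckRSK.antitone_lambdaOf _ _, fun lam hlam =>
    GrothendieckRSK.real_lambdaOf_eq hN hx hβ hAm hBm hindep hA hB1 hB0 hlam⟩
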